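/- For a finite undirected simple graph $G$ with $n$ vertices, the density of a subgraph is its number of edges divided by its number of vertices. In all problems below an input consists of such a graph $G$ and a positive integer $k$, and $N$ denotes its size in bits. For $\delta\in(0,1]$ and an integer $t\ge 1$, an algorithm solves $\mathrm{PolyGapDkS}(\delta,t)$ if, given $(G,k)$, it accepts whenever (Completeness) there is a set $S$ of exactly $k$ vertices such that the induced subgraph $G[S]$ contains at least $k^{t-\delta}$ copies of the $t$-clique, and it rejects whenever (Soundness) every induced subgraph of $G$ on at most $k$ vertices has density less than $k^{\delta}$. An algorithm approximates Densest At-Least-$k$-Subgraph (DAL$k$S) to within a factor $\rho$ if, given $(G,k)$ with $1\le k\le n$, it returns a set $S$ of at least $k$ vertices such that every set $S'$ of at least $k$ vertices satisfies $\mathrm{den}(G[S'])\le\rho\cdot\mathrm{den}(G[S])$. Theorem. Suppose that, for every $\delta\in(0,1]$ and every integer $t\ge1$, no polynomial-time algorithm solves $\mathrm{PolyGapDkS}(\delta,t)$. Then, for every $\varepsilon>0$, no polynomial-time algorithm approximates DAL$k$S to within a factor of $2-\varepsilon$. Moreover, suppose that, for every $\delta\in(0,1]$, every integer $t\ge1$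 and every function $f:\mathbb N\to\mathbb N$, no algorithm running in time $f(k)\cdot N^{O(1)}$ solves $\mathrm{PolyGapDkS}(\delta,t)$. Then, for every $\varepsilon>0$ and every function $f:\mathbb N\to\mathbb N$, no algorithm running in time $f(k)\cdot N^{O(1)}$ approximates DAL$k$S to within a factor of $2-\varepsilon$. -/

import Mathlib

/-!
# Random access machines

Algorithms are programs of a unit-cost random access machine over the natural numbers.  A program
uses finitely many registers and an unbounded memory that is accessed through addresses held in
registers.  The arithmetic is addition and truncated subtraction, one step each; multiplication is
not a primitive.  After `T` steps all stored numbers have at most `T` bits more than the numbers of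
the input and of the program text, so that this machine and the multitape Turing machine simulate
each other with polynomial overhead, and "polynomial time" and "fixed-parameter tractable" have
their usual meaning.
-/

namespace RAM

/-- A machine state: the contents of the registers and of the memory cells. -/
structure State where
  reg : ℕ → ℕ
  mem : ℕ → ℕ

/-- Assign the value `v` to register `r`. -/
def State.setReg (s : State) (r v : ℕ) : State :=
  { s with reg := Function.update s.reg r v }

/-- Write the value `v` to memory cell `a`. -/
def State.setMem (s : State) (a v : ℕ) : State :=
  { s with mem := Function.update s.mem a v }

/-- Programs. All arguments are names of registers, except for the literal `c` in `const r c`. -/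
inductive Program where
  /-- do nothing -/
  | skip : Program
  /-- `r := c` -/
  | const (r c : ℕ) : Program
  /-- `r := x` -/
  | move (r x : ℕ) : Program
  /-- `r := x + y` -/
  | add (r x y : ℕ) : Program
  /-- `r := x - y`, truncated at zero -/
  | sub (r x y : ℕ) : Program
  /-- `r := mem[x]` -/
  | load (r x : ℕ) : Program
  /-- `mem[r] := x` -/
  | store (r x : ℕ) : Program
  /-- first `p`, then `q` -/
  | seq (p q : Program) : Program
  /-- if `r ≠ 0` then `p` else `q` -/
  | cond (r : ℕ) (p q : Program) : Program
  /-- while `r ≠ 0` do `p` -/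
  | loop (r : ℕ) (p : Program) : Program

/-- `Exec p s s' T`: the program `p`, started in state `s`, halts in state `s'` after exactly `T`
steps.  Every primitive instruction and every evaluation of the test of a conditional or of a loop
is one step. -/
inductive Exec : Program → State → State → ℕ → Prop where
  | skip (s : State) : Exec .skip s s 1
  | const (s : State) (r c : ℕ) : Exec (.const r c) s (s.setReg r c) 1
  | move (s : State) (r x : ℕ) : Exec (.move r x) s (s.setReg r (s.reg x)) 1
  | add (s : State) (r x y : ℕ) : Exec (.add r x y) s (s.setReg r (s.reg x + s.reg y)) 1
  | sub (s : State) (r x y : ℕ) : Exec (.sub r x y) s (s.setReg r (s.reg x - s.reg y)) 1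
  | load (s : State) (r x : ℕ) : Exec (.load r x) s (s.setReg r (s.mem (s.reg x))) 1
  | store (s : State) (r x : ℕ) : Exec (.store r x) s (s.setMem (s.reg r) (s.reg x)) 1
  | seq {p q : Program} {s s' s'' : State} {T T' : ℕ} :
      Exec p s s' T → Exec q s' s'' T' → Exec (.seq p q) s s'' (T + T')
  | cond_true {r : ℕ} {p q : Program} {s s' : State} {T : ℕ} :
      s.reg r ≠ 0 → Exec p s s' T → Exec (.cond r p q) s s' (T + 1)
  | cond_false {r : ℕ} {p q : Program} {s s' : State} {T : ℕ} :
      s.reg r = 0 → Exec q s s' T → Exec (.cond r p q) s s' (T + 1)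
  | loop_stop {r : ℕ} {p : Program} {s : State} :
      s.reg r = 0 → Exec (.loop r p) s s 1
  | loop_step {r : ℕ} {p : Program} {s s' s'' : State} {T T' : ℕ} :
      s.reg r ≠ 0 → Exec p s s' T → Exec (.loop r p) s' s'' T' →
        Exec (.loop r p) s s'' (T + T' + 1)

/-- The machine is deterministic. -/
theorem Exec.deterministic {p : Program} {s s₁ s₂ : State} {T₁ T₂ : ℕ}
    (h₁ : Exec p s s₁ T₁) (h₂ : Exec p s s₂ T₂) : s₁ = s₂ ∧ T₁ = T₂ := by
  induction h₁ generalizing s₂ T₂ with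
  | skip | const | move | add | sub | load | store => cases h₂; exact ⟨rfl, rfl⟩
  | seq _ _ ih ih' =>
    cases h₂ with
    | seq a b =>
      obtain ⟨rfl, rfl⟩ := ih a
      obtain ⟨rfl, rfl⟩ := ih' b
      exact ⟨rfl, rfl⟩
  | cond_true h _ ih =>
    cases h₂ with
    | cond_true _ a => obtain ⟨rfl, rfl⟩ := ih a; exact ⟨rfl, rfl⟩
    | cond_false h' _ => exact absurd h' h
  | cond_false h _ ih =>
    cases h₂ with
    | cond_true h' _ => exact absurd h h'
    | cond_false _ a => obtain ⟨rfl, rfl⟩ := ih a; exact ⟨rfl, rfl⟩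
  | loop_stop h =>
    cases h₂ with
    | loop_stop _ => exact ⟨rfl, rfl⟩
    | loop_step h' _ _ => exact absurd h h'
  | loop_step h _ _ ih ih' =>
    cases h₂ with
    | loop_stop h' => exact absurd h' h
    | loop_step _ a b =>
      obtain ⟨rfl, rfl⟩ := ih a
      obtain ⟨rfl, rfl⟩ := ih' b
      exact ⟨rfl, rfl⟩

end RAM

/-!
# Graphs as inputs

An input is a graph `G` on the vertex set `Fin n` together with a number `k`.
-/

open Classical in
/-- The initial state on input `(G, k)`: register `0` holds the number `n` of vertices, register `1`
holds `k`, and memory cell `i * n + j` holds the entry `(i, j)` of the adjacency matrix for all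
`i, j < n`.  All other registers and cells hold `0`. -/
noncomputable def RAM.input {n : ℕ} (G : SimpleGraph (Fin n)) (k : ℕ) : RAM.State where
  reg r := if r = 0 then n else if r = 1 then k else 0
  mem a := if ∃ i j : Fin n, a = (i : ℕ) * n + (j : ℕ) ∧ G.Adj i j then 1 else 0

/-- The number of bits of an input: the adjacency matrix and the binary expansion of `k`. -/
def inputSize (n k : ℕ) : ℕ := n ^ 2 + Nat.size k

/-- A decision algorithm accepts if register `0` is nonzero when it halts. -/
def RAM.State.Accepts (s : RAM.State) : Prop := s.reg 0 ≠ 0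

/-- The set of vertices `v` that an algorithm returns: those with a nonzero entry in memory
cell `v` when it halts. -/
def RAM.State.vertexSet (s : RAM.State) (n : ℕ) : Finset (Fin n) :=
  Finset.univ.filter fun v : Fin n => s.mem v ≠ 0

/-!
# Densities and cliques
-/

/-- The density of the subgraph of `G` induced by `S`: its number of edges divided by its number
of vertices. -/
noncomputable def density {n : ℕ} (G : SimpleGraph (Fin n)) (S : Finset (Fin n)) : ℝ :=
  ((G.induce (S : Set (Fin n))).edgeSet.ncard : ℝ) / (S.card : ℝ)

/-- The number of `t`-cliques in the subgraph of `G` induced by `S`. -/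
noncomputable def cliqueCount {n : ℕ} (G : SimpleGraph (Fin n)) (S : Finset (Fin n)) (t : ℕ) : ℕ :=
  ((G.induce (S : Set (Fin n))).cliqueSet t).ncard

/-!
# The two problems
-/

/-- Completeness case of `PolyGapDkS(δ, t)`: some set of `k` vertices induces at least `k ^ (t - δ)`
copies of the `t`-clique. -/
def PolyGapDkS.Completeness (δ : ℝ) (t : ℕ) {n : ℕ} (G : SimpleGraph (Fin n)) (k : ℕ) : Prop :=
  ∃ S : Finset (Fin n), S.card = k ∧ (k : ℝ) ^ ((t : ℝ) - δ) ≤ (cliqueCount G S t : ℝ)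

/-- Soundness case of `PolyGapDkS(δ, t)`: all subgraphs on at most `k` vertices have density less
than `k ^ δ`. -/
def PolyGapDkS.Soundness (δ : ℝ) {n : ℕ} (G : SimpleGraph (Fin n)) (k : ℕ) : Prop :=
  ∀ S : Finset (Fin n), S.card ≤ k → density G S < (k : ℝ) ^ δ

/-- The program `p` solves `PolyGapDkS(δ, t)` within the time bound `time`, which may depend on the
input size and on `k`: on every input `(G, k)` with `k ≥ 1` it halts in time, it accepts in the
completeness case, and it rejects in the soundness case. -/
def SolvesPolyGapDkS (δ : ℝ) (t : ℕ) (p : RAM.Program) (time : ℕ → ℕ → ℕ) : Prop :=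
  ∀ (n : ℕ) (G : SimpleGraph (Fin n)) (k : ℕ), 1 ≤ k →
    ∃ (s : RAM.State) (T : ℕ), RAM.Exec p (RAM.input G k) s T ∧ T ≤ time (inputSize n k) k ∧
      (PolyGapDkS.Completeness δ t G k → s.Accepts) ∧
      (PolyGapDkS.Soundness δ G k → ¬ s.Accepts)

/-- The program `p` approximates Densest At-Least-`k`-Subgraph to within the factor `ρ` and within
the time bound `time`: on every input `(G, k)` with `1 ≤ k ≤ |V(G)|` it halts in time and returns a
set of at least `k` vertices whose density is at least the maximum density of such a set divided
by `ρ`. -/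
def ApproximatesDALkS (ρ : ℝ) (p : RAM.Program) (time : ℕ → ℕ → ℕ) : Prop :=
  ∀ (n : ℕ) (G : SimpleGraph (Fin n)) (k : ℕ), 1 ≤ k → k ≤ n →
    ∃ (s : RAM.State) (T : ℕ), RAM.Exec p (RAM.input G k) s T ∧ T ≤ time (inputSize n k) k ∧
      k ≤ (s.vertexSet n).card ∧
      ∀ S : Finset (Fin n), k ≤ S.card → density G S ≤ ρ * density G (s.vertexSet n)

/-- Polynomial time bounds in the input size `N`. -/
def polyTime (q : Polynomial ℕ) (N _k : ℕ) : ℕ := q.eval N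

/-- Time bounds `f(k) * N ^ c` in the input size `N` and the parameter `k`. -/
def fptTime (f : ℕ → ℕ) (c : ℕ) (N k : ℕ) : ℕ := f k * N ^ c

/-! ### Programs that compute by bounded sums -/

namespace RAM

/-! ### Running loops -/

/-! Both parts come from one reduction from the gap problem with δ = 1/10 and cliques of size t = d
+ 1. Put g = ⌊k^(1/10)⌋ and w = g^7. The reduced graph has a vertex for every t-tuple of vertices of
G and w vertices for every (t-1)-tuple; a t-tuple that is a clique is joined to all w copies of each
of its t facets (delete one entry). A disjoint complete bipartite graph has sides k^(t-1) w and t²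
w. The size threshold is K = t k^(t-1) w, so the bipartite part has t w K edges.

Completeness (`exists_dense_set`): a k-set rich in cliques provides K ordered cliques. Their facets
lie among k^(t-1) tuples, whose copies are only K/t vertices. Together with the bipartite part, at
most (1 + 3/t) K vertices span 2 t w K edges.

Soundness (`mul_arcCount_le`): a set S of at least K vertices has density at most (1 + 3/u) t w,
where u grows with 1/ε. The bipartite part gives at most t w K edges. If |S| ≥ t K this is
negligible beside the trivial bound t w |S| on the other edges. Otherwise the facets in S are so few
that a typical clique in S has fewer than 2t/u of its facets in a given copy. The exceptional
cliques cost a factor of order g^6 per facet; this is affordable because a clique has w = g^7 copies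
of each facet to reach, while all copies in S count towards |S|.

The core is `card_clique_many_facets_le`. Given a clique with many facets in a small set H,
coordinates are exposed as long as the number of facets of H agreeing with the exposed entries stays
below a threshold M(s), with s the number of hidden coordinates. When this stops, each hidden
coordinate has fewer than M(s)/M(s-1) possible values. A ratio g^6 suffices for a direct count. A
ratio g^a is needed to make M exceed |H| after only 2t/u coordinates; then local sparsity enters
through `card_heavy_lt` and `card_many_common_neighbors_le`: few choices of the other entries have
g³ or more common neighbours among the candidates.

On the machine, the reduction writes the new adjacency matrix behind the old one, runs the given
program with shifted registers and addresses (`Exec.relocate`), and compares the density of the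
returned set with the soundness bound. The new parameter K depends only on k and the new size is
polynomial in n, so polynomial and fixed-parameter time bounds are both preserved. -/

theorem exec_loop_of_invariant {r : ℕ} {p : Program} (I : ℕ → State → Prop) (N C : ℕ)
    (hstep : ∀ i < N, ∀ s, I i s → s.reg r ≠ 0 ∧ ∃ s' T, Exec p s s' T ∧ T ≤ C ∧ I (i + 1) s')
    (hend : ∀ s, I N s → s.reg r = 0) (s : State) (h0 : I 0 s) :
    ∃ s' T, Exec (.loop r p) s s' T ∧ T ≤ N * (C + 1) + 1 ∧ I N s' := by
  -- Induction on the number d of remaining rounds, because `Exec` peels a loop from the front.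
  have key : ∀ d i s, i + d = N → I i s →
      ∃ s' T, Exec (.loop r p) s s' T ∧ T ≤ d * (C + 1) + 1 ∧ I N s' := by
    intro d
    induction d with
    | zero =>
      intro i s hi hI
      obtain rfl : i = N := by omega
      exact ⟨s, 1, Exec.loop_stop (hend s hI), by omega, hI⟩
    | succ d ih =>
      intro i s hi hI
      obtain ⟨hr, s', T, he, hT, hI'⟩ := hstep i (by omega) s hI
      obtain ⟨s'', T', he', hT', hI''⟩ := ih (i + 1) s' (by omega) hI'
      refine ⟨s'', T + T' + 1, .loop_step hr he he', ?_, hI''⟩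
      have : (d + 1) * (C + 1) = d * (C + 1) + C + 1 := by ring
      omega
  exact key N 0 s (by omega) h0

/-! ### Contexts and computable functions -/

/-- A type whose elements are tuples of `dim` numbers. -/
class Ctx (α : Type) where
  dim : ℕ
  val : α → ℕ → ℕ

instance : Ctx Unit := ⟨0, fun _ _ => 0⟩

/-- The newest variable receives the largest index, so extending a tuple leaves the placement of the
older components intact. -/
instance {α : Type} [Ctx α] : Ctx (α × ℕ) :=
  ⟨Ctx.dim α + 1, fun p i => if i = Ctx.dim α then p.2 else Ctx.val p.1 i⟩

/-- All components of the tuple are at most `B`. -/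
def Ctx.Bounded {α : Type} [Ctx α] (a : α) (B : ℕ) : Prop := ∀ i < Ctx.dim α, Ctx.val a i ≤ B

/-- The components of the tuple are held in the registers named by `ρ`. -/
def Ctx.Holds {α : Type} [Ctx α] (ρ : ℕ → ℕ) (s : State) (a : α) : Prop :=
  ∀ i < Ctx.dim α, s.reg (ρ i) = Ctx.val a i

/-- The program `P` writes `v` to register `b`, in at most `C` steps; it changes neither the memory
nor the registers below `b` or from `R` on. -/
def Evaluates (P : Program) (b R : ℕ) (s : State) (v C : ℕ) : Prop :=
  ∃ s' T, Exec P s s' T ∧ T ≤ C ∧ s'.mem = s.mem ∧ (∀ r, r < b ∨ R ≤ r → s'.reg r = s.reg r) ∧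
    s'.reg b = v

/-- The functions of a tuple and of the memory that are bounded by a polynomial in the tuple, and
computed in polynomial time without changing the memory. -/
def PolyComputable {α : Type} [Ctx α] (f : α → (ℕ → ℕ) → ℕ) : Prop :=
  ∃ e, (∀ a m B, Ctx.Bounded a B → f a m ≤ (B + 2) ^ e) ∧
    ∀ ρ b, (∀ i < Ctx.dim α, ρ i < b) → ∃ P R, b < R ∧ ∀ s a B, Ctx.Holds ρ s a → Ctx.Bounded a B →
      Evaluates P b R s (f a s.mem) ((B + 2) ^ e)

variable {α : Type} [Ctx α]

theorem Ctx.Holds.congr {ρ : ℕ → ℕ} {s s' : State} {a : α} {b : ℕ} (h : Ctx.Holds ρ s a)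
    (hρ : ∀ i < Ctx.dim α, ρ i < b) (hs : ∀ r < b, s'.reg r = s.reg r) : Ctx.Holds ρ s' a :=
  fun i hi => by rw [hs _ (hρ i hi), h i hi]

/-- Extend a placement of `d` components by one more register. -/
def extendPlacement (d : ℕ) (ρ : ℕ → ℕ) (c : ℕ) : ℕ → ℕ := fun i => if i = d then c else ρ i

theorem extendPlacement_lt {d b b' c : ℕ} {ρ : ℕ → ℕ} (hρ : ∀ i < d, ρ i < b) (hb : b ≤ b')
    (hc : c < b') : ∀ i < d + 1, extendPlacement d ρ c i < b' := by
  intro i hi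
  unfold extendPlacement
  split_ifs with h
  · exact hc
  · exact (hρ i (by omega)).trans_le hb

theorem Ctx.Holds.extend {ρ : ℕ → ℕ} {s : State} {a : α} {c v : ℕ} (h : Ctx.Holds ρ s a)
    (hc : s.reg c = v) :
    Ctx.Holds (α := α × ℕ) (extendPlacement (Ctx.dim α) ρ c) s (a, v) := by
  intro i hi
  change i < Ctx.dim α + 1 at hi
  change s.reg (if i = Ctx.dim α then c else ρ i) = if i = Ctx.dim α then v else Ctx.val a i
  split_ifs with h'
  · exact hc
  · exact h i (by omega)

theorem Ctx.Bounded.extend {a : α} {B v : ℕ} (h : Ctx.Bounded a B) (hv : v ≤ B) :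
    Ctx.Bounded (α := α × ℕ) (a, v) B := by
  intro i hi
  change i < Ctx.dim α + 1 at hi
  change (if i = Ctx.dim α then v else Ctx.val a i) ≤ B
  split_ifs with h'
  · exact hv
  · exact h i (by omega)

theorem Ctx.Bounded.mono {a : α} {B B' : ℕ} (h : Ctx.Bounded a B) (hB : B ≤ B') :
    Ctx.Bounded a B' := fun i hi => (h i hi).trans hB

/-! ### Bounds by powers -/

theorem pow_add_two_mono (B : ℕ) {e e' : ℕ} (h : e ≤ e') : (B + 2) ^ e ≤ (B + 2) ^ e' :=
  Nat.pow_le_pow_right (by omega) h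

/-- Because the base is at least 2, constants and factors are absorbed into the exponent; every time
bound can therefore be a single power of B + 2. -/
theorem add_le_pow_add_two {B x y e₁ e₂ : ℕ} (hx : x ≤ (B + 2) ^ e₁) (hy : y ≤ (B + 2) ^ e₂) :
    x + y ≤ (B + 2) ^ (e₁ + e₂ + 1) := by
  have h1 := hx.trans (pow_add_two_mono B (e' := e₁ + e₂) (by omega))
  have h2 := hy.trans (pow_add_two_mono B (e' := e₁ + e₂) (by omega))
  have : (B + 2) ^ (e₁ + e₂ + 1) = (B + 2) ^ (e₁ + e₂) * (B + 2) := pow_succ _ _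
  nlinarith

theorem mul_le_pow_add_two {B x y e₁ e₂ : ℕ} (hx : x ≤ (B + 2) ^ e₁) (hy : y ≤ (B + 2) ^ e₂) :
    x * y ≤ (B + 2) ^ (e₁ + e₂) := by
  rw [pow_add]; exact Nat.mul_le_mul hx hy

theorem le_pow_add_two (B c : ℕ) : c ≤ (B + 2) ^ c :=
  (Nat.lt_two_pow_self).le.trans (Nat.pow_le_pow_left (by omega) c)

theorem add_two_le_pow {B x e : ℕ} (hx : x ≤ (B + 2) ^ e) : x + 2 ≤ (B + 2) ^ (e + 2) := by
  have h : 1 ≤ (B + 2) ^ e := Nat.one_le_pow _ _ (by omega)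
  have : (B + 2) ^ (e + 2) = (B + 2) ^ e * (B + 2) * (B + 2) := by ring
  nlinarith [Nat.mul_le_mul h (Nat.zero_le B)]

theorem le_pow_of_add_two_le {B x y e e' : ℕ} (hx : x ≤ (B + 2) ^ e) (hy : y ≤ x + 2)
    (he : e + 2 ≤ e') : y ≤ (B + 2) ^ e' :=
  hy.trans ((add_two_le_pow hx).trans (pow_add_two_mono B he))

/-! ### Closure properties -/

namespace PolyComputable

theorem congr {f g : α → (ℕ → ℕ) → ℕ} (hf : PolyComputable f) (h : ∀ a m, g a m = f a m) :
    PolyComputable g := by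
  obtain rfl : g = f := by funext a m; exact h a m
  exact hf

theorem const (c : ℕ) : PolyComputable (fun (_ : α) _ => c) := by
  refine ⟨c, fun a m B _ => le_pow_add_two B c, fun ρ b _ => ⟨.const b c, b + 1, by omega, ?_⟩⟩
  intro s a B _ _
  refine ⟨_, 1, .const s b c, Nat.one_le_pow _ _ (by omega), rfl, fun r hr => ?_, ?_⟩
  · simp only [State.setReg]; rw [Function.update_of_ne (by omega)]
  · simp [State.setReg]

theorem var : PolyComputable (fun (a : α × ℕ) _ => a.2) := by
  have hv : ∀ (a : α × ℕ), Ctx.val a (Ctx.dim α) = a.2 := fun a => if_pos rfl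
  have hd : Ctx.dim α < Ctx.dim (α × ℕ) := Nat.lt_succ_self _
  refine ⟨1, fun a m B h => ?_, fun ρ b hρ => ⟨.move b (ρ (Ctx.dim α)), b + 1, by omega, ?_⟩⟩
  · have := h _ hd
    rw [hv] at this
    rw [pow_one]
    exact this.trans (by omega)
  intro s a B hs _
  refine ⟨_, 1, .move s b _, Nat.one_le_pow _ _ (by omega), rfl, fun r hr => ?_, ?_⟩
  · simp only [State.setReg]; rw [Function.update_of_ne (by omega)]
  · simp [State.setReg, hs _ hd, hv]

theorem weaken {f : α → (ℕ → ℕ) → ℕ} (hf : PolyComputable f) :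
    PolyComputable (fun (a : α × ℕ) m => f a.1 m) := by
  obtain ⟨e, h1, h2⟩ := hf
  have hB : ∀ (a : α × ℕ) B, Ctx.Bounded a B → Ctx.Bounded a.1 B := by
    intro a B h i hi
    have := h i (Nat.lt_succ_of_lt hi)
    change (if i = Ctx.dim α then a.2 else Ctx.val a.1 i) ≤ B at this
    rwa [if_neg (by omega)] at this
  refine ⟨e, fun a m B h => h1 _ _ _ (hB a B h), fun ρ b hρ => ?_⟩
  obtain ⟨P, R, hR, hP⟩ := h2 ρ b (fun i hi => hρ i (Nat.lt_succ_of_lt hi))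
  refine ⟨P, R, hR, fun s a B hs ha => hP s a.1 B (fun i hi => ?_) (hB a B ha)⟩
  have := hs i (Nat.lt_succ_of_lt hi)
  change s.reg (ρ i) = (if i = Ctx.dim α then a.2 else Ctx.val a.1 i) at this
  rwa [if_neg (by omega)] at this

/-- Two evaluations, followed by an instruction that combines the values. -/
theorem binary {f g : α → (ℕ → ℕ) → ℕ} (hf : PolyComputable f) (hg : PolyComputable g)
    (op : ℕ → ℕ → ℕ) (ins : ℕ → ℕ → ℕ → Program)
    (hins : ∀ s r x y, Exec (ins r x y) s (s.setReg r (op (s.reg x) (s.reg y))) 1)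
    (hop : ∀ x y, op x y ≤ x + y) : PolyComputable (fun a m => op (f a m) (g a m)) := by
  obtain ⟨e₁, h1, h1'⟩ := hf
  obtain ⟨e₂, h2, h2'⟩ := hg
  refine ⟨e₁ + e₂ + 3, fun a m B h => ?_, fun ρ b hρ => ?_⟩
  · exact (hop _ _).trans ((add_le_pow_add_two (h1 a m B h) (h2 a m B h)).trans
      (pow_add_two_mono B (by omega)))
  obtain ⟨P, R, hR, hP⟩ := h1' ρ b hρ
  obtain ⟨Q, R', hR', hQ⟩ := h2' ρ (b + 1) (fun i hi => (hρ i hi).trans (by omega))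
  refine ⟨.seq (.seq P Q) (ins b b (b + 1)), max R R', by omega, ?_⟩
  intro s a B hs ha
  obtain ⟨s₁, T₁, e1, t1, m1, k1, v1⟩ := hP s a B hs ha
  obtain ⟨s₂, T₂, e2, t2, m2, k2, v2⟩ :=
    hQ s₁ a B (hs.congr hρ fun r hr => k1 r (.inl hr)) ha
  refine ⟨_, _, .seq (.seq e1 e2) (hins _ _ _ _), ?_, ?_, fun r hr => ?_, ?_⟩
  · exact le_pow_of_add_two_le (add_le_pow_add_two t1 t2) (by omega) (by omega)
  · simp [State.setReg, m1, m2]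
  · simp only [State.setReg]
    rw [Function.update_of_ne (by omega), k2 r (by omega), k1 r (by omega)]
  · simp [State.setReg, v2, k2 b (by omega), v1, m1]

theorem add {f g : α → (ℕ → ℕ) → ℕ} (hf : PolyComputable f) (hg : PolyComputable g) :
    PolyComputable (fun a m => f a m + g a m) :=
  hf.binary hg (· + ·) .add (fun s r x y => .add s r x y) fun _ _ => le_rfl

theorem sub {f g : α → (ℕ → ℕ) → ℕ} (hf : PolyComputable f) (hg : PolyComputable g) :
    PolyComputable (fun a m => f a m - g a m) :=
  hf.binary hg (· - ·) .sub (fun s r x y => .sub s r x y)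
    fun x y => (Nat.sub_le x y).trans (Nat.le_add_right x y)

theorem ite {c f g : α → (ℕ → ℕ) → ℕ} (hc : PolyComputable c) (hf : PolyComputable f)
    (hg : PolyComputable g) : PolyComputable (fun a m => if c a m ≠ 0 then f a m else g a m) := by
  obtain ⟨e₀, h0, h0'⟩ := hc
  obtain ⟨e₁, h1, h1'⟩ := hf
  obtain ⟨e₂, h2, h2'⟩ := hg
  refine ⟨e₀ + (e₁ + e₂) + 3, fun a m B h => ?_, fun ρ b hρ => ?_⟩
  · dsimp only
    split_ifs
    · exact (h1 a m B h).trans (pow_add_two_mono B (by omega))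
    · exact (h2 a m B h).trans (pow_add_two_mono B (by omega))
  obtain ⟨P₀, R₀, hR₀, hP₀⟩ := h0' ρ b hρ
  obtain ⟨P, R, hR, hP⟩ := h1' ρ b hρ
  obtain ⟨Q, R', hR', hQ⟩ := h2' ρ b hρ
  refine ⟨.seq P₀ (.cond b P Q), max R₀ (max R R'), by omega, ?_⟩
  intro s a B hs ha
  obtain ⟨s₀, T₀, e0, t0, m0, k0, v0⟩ := hP₀ s a B hs ha
  have hs₀ : Ctx.Holds ρ s₀ a := hs.congr hρ fun r hr => k0 r (.inl hr)
  by_cases hv : c a s.mem ≠ 0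
  · obtain ⟨s₁, T₁, E1, t1, m1, k1, v1⟩ := hP s₀ a B hs₀ ha
    refine ⟨s₁, _, .seq e0 (.cond_true (by rwa [v0]) E1), ?_, m1.trans m0, fun r hr => ?_, ?_⟩
    · exact le_pow_of_add_two_le (add_le_pow_add_two t0 (t1.trans (pow_add_two_mono B
        (e' := e₁ + e₂) (by omega)))) (by omega) (by omega)
    · rw [k1 r (by omega), k0 r (by omega)]
    · rw [v1, m0]; exact (if_pos hv).symm
  · obtain ⟨s₁, T₁, E1, t1, m1, k1, v1⟩ := hQ s₀ a B hs₀ ha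
    refine ⟨s₁, _, .seq e0 (.cond_false (by rw [v0]; simpa using hv) E1), ?_, m1.trans m0,
      fun r hr => ?_, ?_⟩
    · exact le_pow_of_add_two_le (add_le_pow_add_two t0 (t1.trans (pow_add_two_mono B
        (e' := e₁ + e₂) (by omega)))) (by omega) (by omega)
    · rw [k1 r (by omega), k0 r (by omega)]
    · rw [v1, m0]; exact (if_neg hv).symm

/-- Only the zero test of a cell is offered: the content of a cell is not bounded in terms of the
tuple, so reading it would violate the size condition. -/
theorem memNeZero {f : α → (ℕ → ℕ) → ℕ} (hf : PolyComputable f) :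
    PolyComputable (fun a m => if m (f a m) ≠ 0 then 1 else 0) := by
  obtain ⟨e, h1, h2⟩ := hf
  refine ⟨e + 4, fun a m B h => ?_, fun ρ b hρ => ?_⟩
  · have : 1 ≤ (B + 2) ^ (e + 4) := Nat.one_le_pow _ _ (by omega)
    dsimp only
    split_ifs <;> omega
  obtain ⟨P, R, hR, hP⟩ := h2 ρ b hρ
  refine ⟨.seq (.seq P (.load b b)) (.cond b (.const b 1) .skip), R, hR, ?_⟩
  intro s a B hs ha
  obtain ⟨s₁, T₁, E1, t1, m1, k1, v1⟩ := hP s a B hs ha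
  have ht : T₁ + 1 + (1 + 1) ≤ (B + 2) ^ (e + 4) :=
    le_pow_of_add_two_le (add_two_le_pow t1) (by omega) (by omega)
  by_cases hv : s.mem (f a s.mem) ≠ 0
  · refine ⟨_, _, .seq (.seq E1 (.load _ _ _)) (.cond_true ?_ (.const _ _ _)), ht, ?_,
      fun r hr => ?_, ?_⟩
    · simpa [State.setReg, v1, m1] using hv
    · simp [State.setReg, m1]
    · simp only [State.setReg]
      rw [Function.update_of_ne (by omega), Function.update_of_ne (by omega), k1 r (by omega)]
    · refine Eq.trans ?_ (if_pos hv).symm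
      simp [State.setReg]
  · refine ⟨_, _, .seq (.seq E1 (.load _ _ _)) (.cond_false ?_ (.skip _)), ht, ?_,
      fun r hr => ?_, ?_⟩
    · simpa [State.setReg, v1, m1] using hv
    · simp [State.setReg, m1]
    · simp only [State.setReg]
      rw [Function.update_of_ne (by omega), k1 r (by omega)]
    · refine Eq.trans ?_ (if_neg hv).symm
      simpa [State.setReg, v1, m1] using hv

/-- Bounded summation over the last variable. -/
theorem sum {f : α → (ℕ → ℕ) → ℕ} {g : α × ℕ → (ℕ → ℕ) → ℕ} (hf : PolyComputable f)
    (hg : PolyComputable g) :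
    PolyComputable (fun a m => ∑ i ∈ Finset.range (f a m), g (a, i) m) := by
  obtain ⟨e₁, h1, h1'⟩ := hf
  obtain ⟨e₂, h2, h2'⟩ := hg
  -- The summation index may exceed B, so the summand is run under the larger bound (B + 2)^(e₁ +
  -- 1).
  have hval : ∀ (a : α) m B i, Ctx.Bounded a B → i < f a m →
      Ctx.Bounded (α := α × ℕ) (a, i) ((B + 2) ^ (e₁ + 1)) := fun a m B i h hi =>
    (h.mono ((show B ≤ (B + 2) ^ 1 by rw [pow_one]; omega).trans (pow_add_two_mono B (by omega)))).extend
      (hi.le.trans ((h1 a m B h).trans (pow_add_two_mono B (by omega))))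
  have hpow : ∀ B, ((B + 2) ^ (e₁ + 1) + 2) ^ e₂ ≤ (B + 2) ^ ((e₁ + 3) * e₂) := fun B => by
    rw [pow_mul]
    exact Nat.pow_le_pow_left (add_two_le_pow le_rfl) _
  refine ⟨e₁ + (e₁ + (e₁ + 3) * e₂ + 4) + 7, fun a m B h => ?_, fun ρ b hρ => ?_⟩
  · refine le_trans (?_ : _ ≤ (B + 2) ^ (e₁ + (e₁ + 3) * e₂)) (pow_add_two_mono B (by omega))
    refine (Finset.sum_le_card_nsmul _ _ ((B + 2) ^ ((e₁ + 3) * e₂)) fun i hi => ?_).trans ?_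
    · exact (h2 _ m _ (hval a m B i h (Finset.mem_range.1 hi))).trans (hpow B)
    · rw [Finset.card_range, smul_eq_mul, pow_add]
      exact Nat.mul_le_mul_right _ (h1 a m B h)
  obtain ⟨P, R, hR, hP⟩ := h1' ρ b hρ
  obtain ⟨Q, R', hR', hQ⟩ := h2' (extendPlacement (Ctx.dim α) ρ (b + 1)) (b + 4)
    (extendPlacement_lt hρ (by omega) (by omega))
  -- Register b counts down, b + 1 is the index, b + 2 the partial sum, b + 3 the constant 1, and b
  -- + 4 receives the summand.
  refine ⟨.seq (.seq (.seq (.seq (.seq P (.const (b + 1) 0)) (.const (b + 2) 0))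
    (.const (b + 3) 1)) (.loop b (.seq (.seq (.seq Q (.add (b + 2) (b + 2) (b + 4)))
      (.add (b + 1) (b + 1) (b + 3))) (.sub b b (b + 3))))) (.move b (b + 2)),
    max R (max R' (b + 5)), by omega, ?_⟩
  intro s a B hs ha
  obtain ⟨s₁, T₁, E1, t1, m1, k1, v1⟩ := hP s a B hs ha
  set N := f a s.mem with hN
  have hN' : N ≤ (B + 2) ^ e₁ := h1 a s.mem B ha
  let I : ℕ → State → Prop := fun i s' => s'.mem = s.mem ∧
    (∀ r, r < b ∨ max R (max R' (b + 5)) ≤ r → s'.reg r = s.reg r) ∧ s'.reg b = N - i ∧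
    s'.reg (b + 1) = i ∧ s'.reg (b + 2) = ∑ j ∈ Finset.range i, g (a, j) s.mem ∧
    s'.reg (b + 3) = 1
  have E2 : Exec (.seq (.seq (.seq P (.const (b + 1) 0)) (.const (b + 2) 0)) (.const (b + 3) 1)) s
      (((s₁.setReg (b + 1) 0).setReg (b + 2) 0).setReg (b + 3) 1) (T₁ + 1 + 1 + 1) :=
    .seq (.seq (.seq E1 (.const _ _ _)) (.const _ _ _)) (.const _ _ _)
  have h0 : I 0 (((s₁.setReg (b + 1) 0).setReg (b + 2) 0).setReg (b + 3) 1) := by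
    refine ⟨by simp [State.setReg, m1], fun r hr => ?_, ?_, ?_, ?_, ?_⟩
    · simp only [State.setReg]
      rw [Function.update_of_ne (by omega), Function.update_of_ne (by omega),
        Function.update_of_ne (by omega), k1 r (by omega)]
    all_goals simp [State.setReg, v1]
  obtain ⟨s₂, T₂, E3, t3, m3, k3, -, -, v3, -⟩ := exec_loop_of_invariant I N
    ((B + 2) ^ ((e₁ + 3) * e₂) + 3) (r := b) (p := .seq (.seq (.seq Q (.add (b + 2) (b + 2) (b + 4)))
      (.add (b + 1) (b + 1) (b + 3))) (.sub b b (b + 3))) (by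
      rintro i hi s' ⟨im, ik, ib, i1, i2, i3⟩
      refine ⟨by omega, ?_⟩
      obtain ⟨s₃, T₃, E3, t3, m3, k3, v3⟩ := hQ s' (a, i) _
        ((hs.congr hρ fun r hr => ik r (.inl hr)).extend i1) (hval a s.mem B i ha hi)
      refine ⟨_, _, .seq (.seq (.seq E3 (.add _ _ _ _)) (.add _ _ _ _)) (.sub _ _ _ _), ?_, ?_⟩
      · have := t3.trans (hpow B)
        omega
      refine ⟨by simp [State.setReg, m3, im], fun r hr => ?_, ?_, ?_, ?_, ?_⟩
      · simp only [State.setReg]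
        rw [Function.update_of_ne (by omega), Function.update_of_ne (by omega),
          Function.update_of_ne (by omega), k3 r (by omega), ik r hr]
      · simp [State.setReg, k3 b (by omega), k3 (b + 3) (by omega), ib, i3]; omega
      · simp [State.setReg, k3 (b + 1) (by omega), k3 (b + 3) (by omega), i1, i3]
      · simp [State.setReg, k3 (b + 2) (by omega), v3, i2, im, Finset.sum_range_succ]
      · simp [State.setReg, k3 (b + 3) (by omega), i3]) (by
      rintro s' ⟨-, -, ib, -⟩
      simpa using ib) _ h0
  refine ⟨_, _, .seq (.seq E2 E3) (.move _ _ _), ?_, ?_, fun r hr => ?_, ?_⟩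
  · have hx : (B + 2) ^ ((e₁ + 3) * e₂) + 3 + 1 ≤ (B + 2) ^ ((e₁ + 3) * e₂ + 4) :=
      le_pow_of_add_two_le (add_two_le_pow (e := (e₁ + 3) * e₂) le_rfl) (by omega) (by omega)
    have h3 := add_two_le_pow (add_two_le_pow (add_le_pow_add_two t1 (mul_le_pow_add_two hN' hx)))
    exact le_pow_of_add_two_le h3 (by omega) (by omega)
  · simp [State.setReg, m3]
  · simp only [State.setReg]
    rw [Function.update_of_ne (by omega), k3 r (by omega)]
  · simp [State.setReg, v3, hN]

end PolyComputable

end RAM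

/-! ### Decidable predicates and further arithmetic -/

namespace RAM

variable {α : Type} [Ctx α]

open Classical in
/-- The predicates of a tuple and of the memory that are decided in polynomial time without changing
the memory. -/
def PolyDecidable (P : α → (ℕ → ℕ) → Prop) : Prop :=
  PolyComputable (fun a m => if P a m then 1 else 0)

namespace PolyDecidable

theorem congr {P Q : α → (ℕ → ℕ) → Prop} (hP : PolyDecidable P) (h : ∀ a m, Q a m ↔ P a m) :
    PolyDecidable Q := by
  obtain rfl : Q = P := by funext a m; exact propext (h a m)
  exact hP

theorem ite {P : α → (ℕ → ℕ) → Prop} [∀ a m, Decidable (P a m)] {f g : α → (ℕ → ℕ) → ℕ}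
    (hP : PolyDecidable P) (hf : PolyComputable f) (hg : PolyComputable g) :
    PolyComputable (fun a m => if P a m then f a m else g a m) :=
  (PolyComputable.ite hP hf hg).congr fun a m => by by_cases h : P a m <;> simp [h]

theorem ne_zero {f : α → (ℕ → ℕ) → ℕ} (hf : PolyComputable f) :
    PolyDecidable (fun a m => f a m ≠ 0) :=
  (hf.ite (.const 1) (.const 0)).congr fun a m => by by_cases h : f a m = 0 <;> simp [h]

theorem lt {f g : α → (ℕ → ℕ) → ℕ} (hf : PolyComputable f) (hg : PolyComputable g) :
    PolyDecidable (fun a m => f a m < g a m) :=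
  (ne_zero (hg.sub hf)).congr fun a m => by simp [Nat.sub_eq_zero_iff_le]

theorem not {P : α → (ℕ → ℕ) → Prop} (hP : PolyDecidable P) :
    PolyDecidable (fun a m => ¬ P a m) := by
  classical
  exact (ite hP (.const 0) (.const 1)).congr fun a m => by by_cases h : P a m <;> simp [h]

theorem and {P Q : α → (ℕ → ℕ) → Prop} (hP : PolyDecidable P) (hQ : PolyDecidable Q) :
    PolyDecidable (fun a m => P a m ∧ Q a m) := by
  classical
  exact (ite hP hQ (.const 0)).congr fun a m => by by_cases h : P a m <;> simp [h]

theorem or {P Q : α → (ℕ → ℕ) → Prop} (hP : PolyDecidable P) (hQ : PolyDecidable Q) :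
    PolyDecidable (fun a m => P a m ∨ Q a m) :=
  (hP.not.and hQ.not).not.congr fun a m => by tauto

theorem le {f g : α → (ℕ → ℕ) → ℕ} (hf : PolyComputable f) (hg : PolyComputable g) :
    PolyDecidable (fun a m => f a m ≤ g a m) :=
  (lt hg hf).not.congr fun a m => by simp

theorem eq {f g : α → (ℕ → ℕ) → ℕ} (hf : PolyComputable f) (hg : PolyComputable g) :
    PolyDecidable (fun a m => f a m = g a m) :=
  ((le hf hg).and (le hg hf)).congr fun a m => by rw [le_antisymm_iff]

theorem mem {f : α → (ℕ → ℕ) → ℕ} (hf : PolyComputable f) :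
    PolyDecidable (fun a m => m (f a m) ≠ 0) :=
  hf.memNeZero.congr fun a m => by by_cases h : m (f a m) = 0 <;> simp [h]

theorem true : PolyDecidable (fun (_ : α) _ => True) :=
  (PolyComputable.const 1).congr fun a m => by simp

theorem forall_fin {d : ℕ} {P : Fin d → α → (ℕ → ℕ) → Prop} (hP : ∀ i, PolyDecidable (P i)) :
    PolyDecidable (fun a m => ∀ i, P i a m) := by
  induction d with
  | zero => exact true.congr fun a m => by simp
  | succ d ih =>
    exact ((hP 0).and (ih fun i => hP i.succ)).congr fun a m => by rw [Fin.forall_fin_succ]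

theorem exists_fin {d : ℕ} {P : Fin d → α → (ℕ → ℕ) → Prop} (hP : ∀ i, PolyDecidable (P i)) :
    PolyDecidable (fun a m => ∃ i, P i a m) :=
  (forall_fin fun i => (hP i).not).not.congr fun a m => by simp

end PolyDecidable

namespace PolyComputable

/-- Multiplication is a sum of equal terms. -/
theorem mul {f g : α → (ℕ → ℕ) → ℕ} (hf : PolyComputable f) (hg : PolyComputable g) :
    PolyComputable (fun a m => f a m * g a m) :=
  (hf.sum hg.weaken).congr fun a m => by simp

theorem pow {f : α → (ℕ → ℕ) → ℕ} (hf : PolyComputable f) (c : ℕ) :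
    PolyComputable (fun a m => f a m ^ c) := by
  induction c with
  | zero => exact (const 1).congr fun a m => by simp
  | succ c ih => exact (ih.mul hf).congr fun a m => by rw [pow_succ]

/-- The number of values below a bound that satisfy a downward closed condition. -/
theorem sum_ite_lt {N x : ℕ} (h : x ≤ N) : (∑ i ∈ Finset.range N, if i < x then 1 else 0) = x := by
  rw [← Finset.card_filter]
  have : {i ∈ Finset.range N | i < x} = Finset.range x := by
    ext i; simp only [Finset.mem_filter, Finset.mem_range]; omega
  rw [this, Finset.card_range]

/-- The quotient counts the i < f with (i + 1) g ≤ f. Linear search is affordable because polynomial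
bounds are in the values, not in their bit lengths. The root below is found in the same way. -/
theorem div {f g : α → (ℕ → ℕ) → ℕ} (hf : PolyComputable f) (hg : PolyComputable g) :
    PolyComputable (fun a m => f a m / g a m) := by
  classical
  have h1 : PolyComputable (fun a m => ∑ i ∈ Finset.range (f a m),
      if (i + 1) * g a m ≤ f a m then 1 else 0) :=
    hf.sum (g := fun a m => if (a.2 + 1) * g a.1 m ≤ f a.1 m then 1 else 0)
      (PolyDecidable.le ((var.add (const 1)).mul hg.weaken) hf.weaken |>.ite (const 1) (const 0))
  refine ((PolyDecidable.ne_zero hg).ite h1 (const 0)).congr fun a m => ?_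
  rcases Nat.eq_zero_or_pos (g a m) with h | h
  · simp [h]
  · rw [if_pos h.ne', ← sum_ite_lt (Nat.div_le_self (f a m) (g a m))]
    refine Finset.sum_congr rfl fun i _ => ?_
    congr 1
    rw [← Nat.succ_le_iff, Nat.le_div_iff_mul_le h]

theorem mod {f g : α → (ℕ → ℕ) → ℕ} (hf : PolyComputable f) (hg : PolyComputable g) :
    PolyComputable (fun a m => f a m % g a m) :=
  (hf.sub (hg.mul (hf.div hg))).congr fun a m => by
    have := Nat.div_add_mod (f a m) (g a m)
    omega

theorem nthRoot {f : α → (ℕ → ℕ) → ℕ} (hf : PolyComputable f) {c : ℕ} (hc : c ≠ 0) :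
    PolyComputable (fun a m => Nat.nthRoot c (f a m)) := by
  classical
  have h1 : PolyComputable (fun a m => ∑ i ∈ Finset.range (f a m),
      if (i + 1) ^ c ≤ f a m then 1 else 0) :=
    hf.sum (g := fun a m => if (a.2 + 1) ^ c ≤ f a.1 m then 1 else 0)
      (PolyDecidable.le ((var.add (const 1)).pow c) hf.weaken |>.ite (const 1) (const 0))
  refine h1.congr fun a m => ?_
  have hle : Nat.nthRoot c (f a m) ≤ f a m :=
    (Nat.le_self_pow hc _).trans (Nat.pow_nthRoot_le (.inl hc))
  rw [← sum_ite_lt hle]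
  refine Finset.sum_congr rfl fun i _ => ?_
  congr 1
  rw [← Nat.succ_le_iff, Nat.le_nthRoot_iff hc]

end PolyComputable

/-! ### Relocation -/

/-- The program `p` with its registers shifted by `R` and its memory shifted by the content of
register `d`. Register `w` is used for the computation of addresses. -/
def Program.relocate (R d w : ℕ) : Program → Program
  | .skip => .skip
  | .const r c => .const (r + R) c
  | .move r x => .move (r + R) (x + R)
  | .add r x y => .add (r + R) (x + R) (y + R)
  | .sub r x y => .sub (r + R) (x + R) (y + R)
  | .load r x => .seq (.add w (x + R) d) (.load (r + R) w)
  | .store r x => .seq (.add w (r + R) d) (.store w (x + R))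
  | .seq p q => .seq (p.relocate R d w) (q.relocate R d w)
  | .cond r p q => .cond (r + R) (p.relocate R d w) (q.relocate R d w)
  | .loop r p => .loop (r + R) (p.relocate R d w)

/-- The state `s` contains the state `s₀`, with registers shifted by `R` and memory shifted by the
content `D` of register `d`. -/
structure Relocates (R d D : ℕ) (s₀ s : State) : Prop where
  reg : ∀ r, s.reg (r + R) = s₀.reg r
  mem : ∀ a, s.mem (D + a) = s₀.mem a
  offset : s.reg d = D

namespace Relocates

variable {R d D w : ℕ} {s₀ s : State}

theorem setReg (h : Relocates R d D s₀ s) (hd : d < R) (r v : ℕ) :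
    Relocates R d D (s₀.setReg r v) (s.setReg (r + R) v) := by
  refine ⟨fun r' => ?_, h.mem, ?_⟩
  · by_cases hr : r' = r
    · subst hr; simp [State.setReg]
    · simp only [State.setReg]
      rw [Function.update_of_ne (by omega), Function.update_of_ne hr, h.reg]
  · simp only [State.setReg]
    rw [Function.update_of_ne (by omega), h.offset]

theorem setMem (h : Relocates R d D s₀ s) (a v : ℕ) :
    Relocates R d D (s₀.setMem a v) (s.setMem (a + D) v) := by
  refine ⟨h.reg, fun a' => ?_, h.offset⟩
  by_cases ha : a' = a
  · subst ha; simp [State.setMem, add_comm]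
  · simp only [State.setMem]
    rw [Function.update_of_ne (by omega), Function.update_of_ne ha, h.mem]

theorem setScratch (h : Relocates R d D s₀ s) (hw : w < R) (hdw : d ≠ w) (v : ℕ) :
    Relocates R d D s₀ (s.setReg w v) := by
  refine ⟨fun r' => ?_, h.mem, ?_⟩
  · simp only [State.setReg]
    rw [Function.update_of_ne (by omega), h.reg]
  · simp only [State.setReg]
    rw [Function.update_of_ne hdw, h.offset]

end Relocates

/-- A simulation step by step. Memory accesses need one extra addition for the address, whence the
factor 2; memory below D and all registers below R except w survive. -/
theorem Exec.relocate {R d D w : ℕ} (hd : d < R) (hw : w < R) (hdw : d ≠ w) {p : Program}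
    {s₀ s₀' : State} {T : ℕ} (h : Exec p s₀ s₀' T) :
    ∀ s, Relocates R d D s₀ s → ∃ s' T', Exec (p.relocate R d w) s s' T' ∧ T' ≤ 2 * T ∧
      Relocates R d D s₀' s' ∧ (∀ r < R, r ≠ w → s'.reg r = s.reg r) ∧
      ∀ a < D, s'.mem a = s.mem a := by
  induction h with
  | skip s₀ => exact fun s h => ⟨s, 1, .skip s, by omega, h, fun _ _ _ => rfl, fun _ _ => rfl⟩
  | const s₀ r c =>
    refine fun s h => ⟨_, 1, .const s _ _, by omega, h.setReg hd _ _, fun r' hr' _ => ?_,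
      fun _ _ => rfl⟩
    simp only [State.setReg]; rw [Function.update_of_ne (by omega)]
  | move s₀ r x =>
    intro s h
    refine ⟨_, 1, .move s _ _, by omega, by rw [h.reg]; exact h.setReg hd _ _,
      fun r' hr' _ => ?_, fun _ _ => rfl⟩
    simp only [State.setReg]; rw [Function.update_of_ne (by omega)]
  | add s₀ r x y =>
    intro s h
    refine ⟨_, 1, .add s _ _ _, by omega, by rw [h.reg, h.reg]; exact h.setReg hd _ _,
      fun r' hr' _ => ?_, fun _ _ => rfl⟩
    simp only [State.setReg]; rw [Function.update_of_ne (by omega)]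
  | sub s₀ r x y =>
    intro s h
    refine ⟨_, 1, .sub s _ _ _, by omega, by rw [h.reg, h.reg]; exact h.setReg hd _ _,
      fun r' hr' _ => ?_, fun _ _ => rfl⟩
    simp only [State.setReg]; rw [Function.update_of_ne (by omega)]
  | load s₀ r x =>
    intro s h
    refine ⟨_, 1 + 1, .seq (.add s _ _ _) (.load _ _ _), by omega, ?_,
      fun r' hr' hr'' => ?_, fun _ _ => rfl⟩
    · have h1 := (h.setScratch hw hdw (s.reg (x + R) + s.reg d)).setReg hd r (s₀.mem (s₀.reg x))
      have h2 : (s.setReg w (s.reg (x + R) + s.reg d)).mem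
          ((s.setReg w (s.reg (x + R) + s.reg d)).reg w) = s₀.mem (s₀.reg x) := by
        simp only [State.setReg, Function.update_self]
        rw [h.offset, add_comm, h.mem, h.reg]
      rw [h2]
      exact h1
    · simp only [State.setReg]
      rw [Function.update_of_ne (by omega), Function.update_of_ne hr'']
  | store s₀ r x =>
    intro s h
    have h2 : (s.setReg w (s.reg (r + R) + s.reg d)).reg w = s₀.reg r + D := by
      simp only [State.setReg, Function.update_self]
      rw [h.offset, h.reg]
    have h3 : (s.setReg w (s.reg (r + R) + s.reg d)).reg (x + R) = s₀.reg x := by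
      simp only [State.setReg]
      rw [Function.update_of_ne (by omega), h.reg]
    refine ⟨_, 1 + 1, .seq (.add s _ _ _) (.store _ _ _), by omega, ?_,
      fun r' hr' hr'' => ?_, fun a ha => ?_⟩
    · rw [h2, h3]
      exact (h.setScratch hw hdw _).setMem _ _
    · simp only [State.setReg, State.setMem]
      rw [Function.update_of_ne hr'']
    · rw [h2]
      simp only [State.setReg, State.setMem]
      rw [Function.update_of_ne (by omega)]
  | seq _ _ ih ih' =>
    intro s h
    obtain ⟨s₁, T₁, e1, t1, h1, r1, m1⟩ := ih s h
    obtain ⟨s₂, T₂, e2, t2, h2, r2, m2⟩ := ih' s₁ h1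
    exact ⟨s₂, _, .seq e1 e2, by omega, h2, fun r hr hr' => (r2 r hr hr').trans (r1 r hr hr'),
      fun a ha => (m2 a ha).trans (m1 a ha)⟩
  | cond_true hr _ ih =>
    intro s h
    obtain ⟨s₁, T₁, e1, t1, h1, r1, m1⟩ := ih s h
    exact ⟨s₁, _, .cond_true (by rwa [h.reg]) e1, by omega, h1, r1, m1⟩
  | cond_false hr _ ih =>
    intro s h
    obtain ⟨s₁, T₁, e1, t1, h1, r1, m1⟩ := ih s h
    exact ⟨s₁, _, .cond_false (by rwa [h.reg]) e1, by omega, h1, r1, m1⟩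
  | loop_stop hr =>
    intro s h
    exact ⟨s, _, Exec.loop_stop (by rwa [h.reg]), by omega, h, fun _ _ _ => rfl, fun _ _ => rfl⟩
  | loop_step hr _ _ ih ih' =>
    intro s h
    obtain ⟨s₁, T₁, e1, t1, h1, r1, m1⟩ := ih s h
    obtain ⟨s₂, T₂, e2, t2, h2, r2, m2⟩ := ih' s₁ h1
    exact ⟨s₂, _, .loop_step (by rwa [h.reg]) e1 e2, by omega, h2,
      fun r hr hr' => (r2 r hr hr').trans (r1 r hr hr'), fun a ha => (m2 a ha).trans (m1 a ha)⟩

/-! ### Writing a table -/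

/-- The entries may depend on the memory that is being overwritten, so they are required to depend
only on cells below the start of the table. -/
theorem PolyComputable.exists_table {f : α → (ℕ → ℕ) → ℕ} {g : α × ℕ → (ℕ → ℕ) → ℕ}
    (hf : PolyComputable f) (hg : PolyComputable g) :
    ∃ e, ∀ ρ b d, (∀ i < Ctx.dim α, ρ i < b) → d < b → ∃ P R, b < R ∧
      ∀ s a B, Ctx.Holds ρ s a → Ctx.Bounded a B →
        (∀ i m, (∀ x < s.reg d, m x = s.mem x) → g (a, i) m = g (a, i) s.mem) →
        ∃ s' T, Exec P s s' T ∧ T ≤ (B + 2) ^ e ∧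
          (∀ r, r < b ∨ R ≤ r → s'.reg r = s.reg r) ∧
          (∀ x < s.reg d, s'.mem x = s.mem x) ∧
          ∀ x, s'.mem (s.reg d + x) =
            if x < f a s.mem then g (a, x) s.mem else s.mem (s.reg d + x) := by
  obtain ⟨e₁, h1, h1'⟩ := hf
  obtain ⟨e₂, h2, h2'⟩ := hg
  have hval : ∀ (a : α) m B i, Ctx.Bounded a B → i < f a m →
      Ctx.Bounded (α := α × ℕ) (a, i) ((B + 2) ^ (e₁ + 1)) := fun a m B i h hi =>
    (h.mono ((show B ≤ (B + 2) ^ 1 by rw [pow_one]; omega).trans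
      (pow_add_two_mono B (by omega)))).extend
      (hi.le.trans ((h1 a m B h).trans (pow_add_two_mono B (by omega))))
  have hpow : ∀ B, ((B + 2) ^ (e₁ + 1) + 2) ^ e₂ ≤ (B + 2) ^ ((e₁ + 3) * e₂) := fun B => by
    rw [pow_mul]
    exact Nat.pow_le_pow_left (add_two_le_pow le_rfl) _
  refine ⟨e₁ + (e₁ + (e₁ + 3) * e₂ + 4) + 7, fun ρ b d hρ hd => ?_⟩
  obtain ⟨P, R, hR, hP⟩ := h1' ρ b hρ
  obtain ⟨Q, R', hR', hQ⟩ := h2' (extendPlacement (Ctx.dim α) ρ (b + 1)) (b + 4)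
    (extendPlacement_lt hρ (by omega) (by omega))
  refine ⟨.seq (.seq (.seq P (.const (b + 1) 0)) (.const (b + 3) 1))
    (.loop b (.seq (.seq (.seq (.seq Q (.add (b + 2) d (b + 1))) (.store (b + 2) (b + 4)))
      (.add (b + 1) (b + 1) (b + 3))) (.sub b b (b + 3)))),
    max R (max R' (b + 5)), by omega, ?_⟩
  intro s a B hs ha hgm
  obtain ⟨s₁, T₁, E1, t1, m1, k1, v1⟩ := hP s a B hs ha
  set N := f a s.mem with hN
  have hN' : N ≤ (B + 2) ^ e₁ := h1 a s.mem B ha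
  let I : ℕ → State → Prop := fun i s' =>
    (∀ r, r < b ∨ max R (max R' (b + 5)) ≤ r → s'.reg r = s.reg r) ∧ s'.reg b = N - i ∧
    s'.reg (b + 1) = i ∧ s'.reg (b + 3) = 1 ∧ (∀ x < s.reg d, s'.mem x = s.mem x) ∧
    ∀ x, s'.mem (s.reg d + x) = if x < i then g (a, x) s.mem else s.mem (s.reg d + x)
  have h0 : I 0 ((s₁.setReg (b + 1) 0).setReg (b + 3) 1) := by
    refine ⟨fun r hr => ?_, ?_, ?_, ?_, fun x _ => ?_, fun x => ?_⟩
    · simp only [State.setReg]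
      rw [Function.update_of_ne (by omega), Function.update_of_ne (by omega), k1 r (by omega)]
    all_goals simp [State.setReg, v1, m1]
  obtain ⟨s₂, T₂, E3, t3, k3, -, -, -, m3, n3⟩ := exec_loop_of_invariant I N
    ((B + 2) ^ ((e₁ + 3) * e₂) + 4) (r := b) (p := .seq (.seq (.seq (.seq Q (.add (b + 2) d (b + 1)))
      (.store (b + 2) (b + 4))) (.add (b + 1) (b + 1) (b + 3))) (.sub b b (b + 3))) (by
      rintro i hi s' ⟨ik, ib, i1, i3, im, iv⟩
      refine ⟨by omega, ?_⟩
      obtain ⟨s₃, T₃, E3, t3, m3, k3, v3⟩ := hQ s' (a, i) _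
        ((hs.congr hρ fun r hr => ik r (.inl hr)).extend i1) (hval a s.mem B i ha hi)
      -- The entry was computed from partly overwritten memory, but the cells below the table are
      -- still the original ones.
      rw [hgm i _ im] at v3
      have hadr : s₃.reg d + s₃.reg (b + 1) = s.reg d + i := by
        rw [k3 d (by omega), ik d (by omega), k3 (b + 1) (by omega), i1]
      refine ⟨_, _, .seq (.seq (.seq (.seq E3 (.add _ _ _ _)) (.store _ _ _)) (.add _ _ _ _))
        (.sub _ _ _ _), ?_, fun r hr => ?_, ?_, ?_, ?_, fun x hx => ?_, fun x => ?_⟩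
      · have := t3.trans (hpow B)
        omega
      · simp only [State.setReg, State.setMem]
        rw [Function.update_of_ne (by omega), Function.update_of_ne (by omega),
          Function.update_of_ne (by omega), k3 r (by omega), ik r hr]
      · simp [State.setReg, State.setMem, k3 b (by omega), k3 (b + 3) (by omega), ib, i3]; omega
      · simp [State.setReg, State.setMem, k3 (b + 1) (by omega), k3 (b + 3) (by omega), i1, i3]
      · simp [State.setReg, State.setMem, k3 (b + 3) (by omega), i3]
      · simp only [State.setReg, State.setMem, Function.update_self, hadr]
        rw [Function.update_of_ne (by omega), m3, im x hx]
      · simp only [State.setReg, State.setMem, Function.update_self, hadr]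
        by_cases hx : x = i
        · subst hx
          rw [Function.update_self, Function.update_of_ne (by omega), if_pos (by omega), v3]
        · rw [Function.update_of_ne (by omega), m3, iv x]
          by_cases hx' : x < i
          · rw [if_pos hx', if_pos (by omega)]
          · rw [if_neg hx', if_neg (by omega)]) (by
      rintro s' ⟨-, ib, -⟩
      simpa using ib) _ h0
  refine ⟨_, _, .seq (.seq (.seq E1 (.const _ _ _)) (.const _ _ _)) E3, ?_, fun r hr => k3 r hr,
    m3, n3⟩
  have hx : (B + 2) ^ ((e₁ + 3) * e₂) + 4 + 1 ≤ (B + 2) ^ ((e₁ + 3) * e₂ + 4 + 2) :=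
    le_pow_of_add_two_le (add_two_le_pow (add_two_le_pow (e := (e₁ + 3) * e₂) le_rfl))
      (by omega) (by omega)
  have h3 := add_two_le_pow (add_le_pow_add_two t1 (mul_le_pow_add_two hN' hx))
  exact le_pow_of_add_two_le h3 (by omega) (by omega)

end RAM

/-!
# Tuples that are cliques in a locally sparse graph
-/

open Finset in
/-- Some subset of prescribed size has at least the average of the whole set. -/
theorem exists_subset_card_eq_average_le {V : Type*} [DecidableEq V] (f : V → ℕ) (W : Finset V)
    (m : ℕ) (hm : m ≤ W.card) :
    ∃ W' ⊆ W, W'.card = m ∧ m * ∑ x ∈ W, f x ≤ W.card * ∑ x ∈ W', f x := by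
  obtain ⟨d, hd⟩ := Nat.exists_eq_add_of_le hm
  induction d generalizing W with
  | zero => exact ⟨W, Subset.rfl, by omega, by rw [hd, Nat.add_zero]⟩
  | succ d ih =>
    -- Deleting an element of minimal value does not lower the average.
    obtain ⟨x, hx, hmin⟩ := W.exists_min_image f (card_pos.1 (by omega))
    have hc : (W.erase x).card = m + d := by rw [card_erase_of_mem hx]; omega
    obtain ⟨W', hW', hm', h⟩ := ih (W.erase x) (by omega) hc
    refine ⟨W', hW'.trans (erase_subset _ _), hm', ?_⟩
    have h1 : (W.erase x).card * f x ≤ ∑ y ∈ W.erase x, f y := by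
      rw [← smul_eq_mul]
      exact card_nsmul_le_sum _ _ _ fun y hy => hmin y (mem_of_mem_erase hy)
    rw [← add_sum_erase _ _ hx, hd]
    rw [hc] at h h1
    rcases Nat.eq_zero_or_pos (m + d) with h0 | h0
    · obtain rfl : m = 0 := by omega
      simp
    · refine Nat.le_of_mul_le_mul_left ?_ h0
      have h2 : (m + (d + 1)) * (m * ∑ y ∈ W.erase x, f y)
          ≤ (m + (d + 1)) * ((m + d) * ∑ y ∈ W', f y) := Nat.mul_le_mul_left _ h
      have h3 := Nat.mul_le_mul_left m h1
      nlinarith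

section

open Finset
open scoped Classical

variable {V : Type*} [Fintype V] (G : SimpleGraph V)

/-- In a locally sparse graph only few vertices are adjacent to a large part of a given set. -/
theorem card_heavy_lt {g k : ℕ} (hg : 8 < g) (hk : 2 * g ^ 3 ≤ k)
    (hG : ∀ S : Finset V, S.card ≤ k → #{p ∈ S ×ˢ S | G.Adj p.1 p.2} ≤ 4 * g * S.card)
    (W : Finset V) (hW : g ^ 3 ≤ W.card) :
    #{v | W.card ≤ g * #{x ∈ W | G.Adj v x}} < g ^ 3 := by
  -- Take g³ heavy vertices V' and, by averaging, g³ elements W' of W that receive at least their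
  -- share of the edges to V'. Then V' and W' span at least g^3 · g^3 / g = g^5 adjacent pairs,
  -- while local sparsity on at most 2g³ vertices allows only 8g^4.
  by_contra! hcon
  obtain ⟨V', hV', hV'c⟩ := exists_subset_card_eq hcon
  have hheavy : ∀ v ∈ V', W.card ≤ g * #{x ∈ W | G.Adj v x} := fun v hv => by
    simpa using hV' hv
  obtain ⟨W', hW', hW'c, hav⟩ :=
    exists_subset_card_eq_average_le (fun x => #{v ∈ V' | G.Adj v x}) W _ hW
  have hswap : ∀ X : Finset V, ∑ x ∈ X, #{v ∈ V' | G.Adj v x} = ∑ v ∈ V', #{x ∈ X | G.Adj v x} :=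
    fun X => by simp only [card_filter]; exact sum_comm
  have h1 : g ^ 3 * W.card ≤ g * ∑ x ∈ W, #{v ∈ V' | G.Adj v x} := by
    rw [hswap, mul_sum, ← hV'c, ← smul_eq_mul]
    exact card_nsmul_le_sum _ _ _ hheavy
  have h2 : ∑ x ∈ W', #{v ∈ V' | G.Adj v x} ≤ 4 * g * (2 * g ^ 3) := by
    have hcard : (V' ∪ W').card ≤ 2 * g ^ 3 := (card_union_le _ _).trans (by omega)
    refine le_trans ?_ ((hG (V' ∪ W') (hcard.trans hk)).trans (Nat.mul_le_mul_left _ hcard))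
    have : ∑ x ∈ W', #{v ∈ V' | G.Adj v x} = #{p ∈ V' ×ˢ W' | G.Adj p.1 p.2} := by
      rw [hswap, card_filter, sum_product]
      simp only [card_filter]
    rw [this]
    refine card_le_card (filter_subset_filter _ (product_subset_product ?_ ?_))
    · exact subset_union_left
    · exact subset_union_right
  have hWpos : 0 < W.card := lt_of_lt_of_le (by positivity) hW
  have h3 : g ^ 3 * g ^ 3 * W.card ≤ 4 * g * (2 * g ^ 3) * g * W.card := by
    calc g ^ 3 * g ^ 3 * W.card = g ^ 3 * (g ^ 3 * W.card) := by ring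
      _ ≤ g ^ 3 * (g * ∑ x ∈ W, #{v ∈ V' | G.Adj v x}) := Nat.mul_le_mul_left _ h1
      _ = g * (g ^ 3 * ∑ x ∈ W, #{v ∈ V' | G.Adj v x}) := by ring
      _ ≤ g * (W.card * ∑ x ∈ W', #{v ∈ V' | G.Adj v x}) := Nat.mul_le_mul_left _ hav
      _ ≤ g * (W.card * (4 * g * (2 * g ^ 3))) :=
        Nat.mul_le_mul_left _ (Nat.mul_le_mul_left _ h2)
      _ = _ := by ring
  have h4 := Nat.le_of_mul_le_mul_right h3 hWpos
  have h5 : g ^ 5 * g ≤ g ^ 5 * 8 := by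
    calc g ^ 5 * g = g ^ 3 * g ^ 3 := by ring
      _ ≤ _ := h4
      _ = g ^ 5 * 8 := by ring
  have := Nat.le_of_mul_le_mul_left h5 (by positivity)
  omega

variable {ι : Type*} [Fintype ι]

/-- The number of tuples with entries in small sets whose entries have many common neighbours in a
given set. -/
theorem card_many_common_neighbors_le {g a : ℕ} (hg : 0 < g)
    (hG : ∀ W : Finset V, g ^ 3 ≤ W.card → #{v | W.card ≤ g * #{x ∈ W | G.Adj v x}} < g ^ 3)
    (U : ι → Finset V) (R : Finset ι) (hU : ∀ i ∈ R, (U i).card ≤ g ^ a) (z : ι → V)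
    (W : Finset V) :
    #{y : ι → V | (∀ i, i ∉ R → y i = z i) ∧ (∀ i ∈ R, y i ∈ U i) ∧
        g ^ 3 ≤ #{x ∈ W | ∀ i ∈ R, G.Adj (y i) x}} ≤ g ^ (3 * R.card) * W.card ^ a := by
  -- One entry is chosen at a time and W is replaced by its neighbours in W. The statement is
  -- general in z because the chosen entry becomes a fixed one.
  induction R using Finset.induction_on generalizing z W with
  | empty =>
    simp only [notMem_empty, not_false_eq_true, forall_true_left, false_imp_iff, implies_true,
      true_and, filter_true, card_empty, mul_zero, pow_zero, one_mul]
    by_cases hW : g ^ 3 ≤ W.card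
    · have : 0 < W.card := lt_of_lt_of_le (by positivity) hW
      refine le_trans (card_le_one.2 ?_) (Nat.one_le_pow _ _ this)
      intro y hy y' hy'
      simp only [mem_filter, mem_univ, true_and] at hy hy'
      funext i
      rw [hy.1, hy'.1]
    · simp [hW]
  | insert i R hi ih =>
    rcases Nat.lt_or_ge W.card (g ^ 3) with hW | hW
    · rw [card_eq_zero.2]
      · exact Nat.zero_le _
      · rw [filter_eq_empty_iff]
        rintro y - ⟨-, -, h⟩
        exact absurd (h.trans (card_filter_le _ _)) (by omega)
    set N : V → Finset V := fun v => {x ∈ W | G.Adj v x} with hN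
    set B : V → Finset (ι → V) := fun v => {y : ι → V | (∀ j, j ∉ R → y j = Function.update z i v j) ∧
      (∀ j ∈ R, y j ∈ U j) ∧ g ^ 3 ≤ #{x ∈ N v | ∀ j ∈ R, G.Adj (y j) x}} with hB
    have hsub : ({y : ι → V | (∀ j, j ∉ insert i R → y j = z j) ∧ (∀ j ∈ insert i R, y j ∈ U j) ∧
        g ^ 3 ≤ #{x ∈ W | ∀ j ∈ insert i R, G.Adj (y j) x}} : Finset (ι → V)) ⊆ (U i).biUnion B := by
      intro y hy
      simp only [mem_filter, mem_univ, true_and] at hy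
      obtain ⟨h1, h2, h3⟩ := hy
      refine mem_biUnion.2 ⟨y i, h2 i (mem_insert_self _ _), ?_⟩
      simp only [hB, mem_filter, mem_univ, true_and]
      refine ⟨fun j hj => ?_, fun j hj => h2 j (mem_insert_of_mem hj), h3.trans (card_le_card ?_)⟩
      · by_cases hji : j = i
        · subst hji; simp
        · rw [Function.update_of_ne hji]
          exact h1 j (by simp [hji, hj])
      · intro x hx
        simp only [hN, mem_filter] at hx ⊢
        exact ⟨⟨hx.1, hx.2 i (mem_insert_self _ _)⟩, fun j hj => hx.2 j (mem_insert_of_mem hj)⟩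
    have hBc : ∀ v, (B v).card ≤ g ^ (3 * R.card) * (N v).card ^ a := fun v =>
      ih (fun j hj => hU j (mem_insert_of_mem hj)) _ _
    have hNW : ∀ v, (N v).card ≤ W.card := fun v => card_filter_le _ _
    -- Fewer than g³ heavy entries keep possibly all of W. Each of the at most g^a light entries
    -- shrinks W by a factor g, and the a-th power of this factor pays for their number.
    have hsum : ∑ v ∈ U i, (N v).card ^ a ≤ g ^ 3 * W.card ^ a := by
      rw [← sum_filter_add_sum_filter_not (U i) (fun v => W.card ≤ g * (N v).card)]
      have h1 : ∑ v ∈ U i with W.card ≤ g * (N v).card, (N v).card ^ a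
          ≤ (g ^ 3 - 1) * W.card ^ a := by
        refine (sum_le_card_nsmul _ _ (W.card ^ a) fun v _ => Nat.pow_le_pow_left (hNW v) a).trans ?_
        rw [smul_eq_mul]
        refine Nat.mul_le_mul_right _ (Nat.le_sub_one_of_lt (lt_of_le_of_lt ?_ (hG W hW)))
        exact card_le_card (filter_subset_filter _ (subset_univ _))
      have h2 : ∑ v ∈ U i with ¬ W.card ≤ g * (N v).card, (N v).card ^ a ≤ W.card ^ a := by
        refine Nat.le_of_mul_le_mul_left ?_ (pow_pos hg a)
        rw [mul_sum]
        refine (sum_le_card_nsmul _ _ (W.card ^ a) fun v hv => ?_).trans ?_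
        · rw [← mul_pow]
          exact Nat.pow_le_pow_left (le_of_not_ge (mem_filter.1 hv).2) a
        · rw [smul_eq_mul]
          exact Nat.mul_le_mul_right _ ((card_filter_le _ _).trans (hU i (mem_insert_self _ _)))
      have h3 : 0 < g ^ 3 := by positivity
      calc _ ≤ (g ^ 3 - 1) * W.card ^ a + W.card ^ a := add_le_add h1 h2
        _ = (g ^ 3 - 1 + 1) * W.card ^ a := by ring
        _ = _ := by rw [Nat.sub_add_cancel h3]
    calc _ ≤ ∑ v ∈ U i, (B v).card := (card_le_card hsub).trans card_biUnion_le
      _ ≤ ∑ v ∈ U i, g ^ (3 * R.card) * (N v).card ^ a := sum_le_sum fun v _ => hBc v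
      _ = g ^ (3 * R.card) * ∑ v ∈ U i, (N v).card ^ a := by rw [mul_sum]
      _ ≤ g ^ (3 * R.card) * (g ^ 3 * W.card ^ a) := Nat.mul_le_mul_left _ hsum
      _ = g ^ (3 * (insert i R).card) * W.card ^ a := by rw [card_insert_of_notMem hi]; ring

/-! ### Exposing the coordinates of a clique -/

/-- The number of pairs in `H` that agree with `y` on `A` and whose first component is not in
`A`. -/
noncomputable def agreeCount (H : Finset (ι × (ι → V))) (A : Finset ι) (y : ι → V) : ℕ :=
  #{p ∈ H | p.1 ∉ A ∧ ∀ i ∈ A, p.2 i = y i}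

omit [Fintype V] in
theorem agreeCount_congr {H : Finset (ι × (ι → V))} {A : Finset ι} {y z : ι → V}
    (h : ∀ i ∈ A, y i = z i) : agreeCount H A y = agreeCount H A z := by
  unfold agreeCount
  congr 1
  refine filter_congr fun p _ => and_congr_right fun _ => forall₂_congr fun i hi => by rw [h i hi]

omit [Fintype V] in
theorem agreeCount_le_card (H : Finset (ι × (ι → V))) (A : Finset ι) (y : ι → V) :
    agreeCount H A y ≤ H.card := card_filter_le _ _

/-- Different values at q select disjoint parts of H; pairs whose missing coordinate is q itself are
lost, so only an inequality holds. -/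
theorem sum_agreeCount_insert_le (H : Finset (ι × (ι → V))) (A : Finset ι) (y : ι → V) {q : ι}
    (hq : q ∉ A) :
    ∑ v, agreeCount H (insert q A) (Function.update y q v) ≤ agreeCount H A y := by
  unfold agreeCount
  rw [card_eq_sum_card_fiberwise (f := fun p : ι × (ι → V) => p.2 q) (t := univ)
    (fun _ _ => mem_univ _)]
  refine sum_le_sum fun v _ => card_le_card fun p hp => ?_
  simp only [mem_filter, mem_insert, not_or] at hp ⊢
  refine ⟨⟨hp.1, hp.2.1.2, fun i hi => ?_⟩, ?_⟩
  · rw [hp.2.2 i (.inr hi), Function.update_of_ne (by rintro rfl; exact hq hi)]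
  · rw [hp.2.2 q (.inl rfl), Function.update_self]

theorem agreeCount_insert_le (H : Finset (ι × (ι → V))) (A : Finset ι) (y : ι → V) {q : ι}
    (hq : q ∉ A) : agreeCount H (insert q A) y ≤ agreeCount H A y := by
  have h := sum_agreeCount_insert_le H A y hq
  refine le_trans ?_ h
  have := single_le_sum (f := fun v => agreeCount H (insert q A) (Function.update y q v))
    (fun _ _ => Nat.zero_le _) (mem_univ (y q))
  simpa using this

/-- The cliques with prescribed entries on `A` all of whose facets outside `A` are in `H`, under the
condition that every further entry has many extensions in `H`. -/
theorem card_clique_fiber_le {g a e m : ℕ} (hg : 0 < g)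
    (hG : ∀ W : Finset V, g ^ 3 ≤ W.card → #{v | W.card ≤ g * #{x ∈ W | G.Adj v x}} < g ^ 3)
    (H : Finset (ι × (ι → V))) (A : Finset ι) (hA : A ≠ univ) (v₀ : V) (z : ι → V)
    (hz : agreeCount H A z < m * g ^ e)
    (he : e ≤ 6 ∨ e = a ∧ g ^ (a + 3 * (Aᶜ.card - 1) + a * a) ≤ m) :
    #{y : ι → V | (∀ i ∈ A, y i = z i) ∧ (∀ i j, i ≠ j → G.Adj (y i) (y j)) ∧
        ∀ q, q ∉ A → (q, Function.update y q v₀) ∈ H ∧ m ≤ agreeCount H (insert q A) y} ≤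
      (g ^ 6 + 1) * agreeCount H A z := by
  set Z : Finset (ι → V) := {y : ι → V | (∀ i ∈ A, y i = z i) ∧
    (∀ i j, i ≠ j → G.Adj (y i) (y j)) ∧
      ∀ q, q ∉ A → (q, Function.update y q v₀) ∈ H ∧ m ≤ agreeCount H (insert q A) y} with hZ
  have hmem : ∀ y ∈ Z, (∀ i ∈ A, y i = z i) ∧ (∀ i j, i ≠ j → G.Adj (y i) (y j)) ∧
      ∀ q, q ∉ A → (q, Function.update y q v₀) ∈ H ∧ m ≤ agreeCount H (insert q A) y :=
    fun y hy => by simpa [hZ] using hy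
  -- The popular values at q. Each accounts for at least m of fewer than m g^e pairs, so there are
  -- fewer than g^e of them.
  set U : ι → Finset V := fun q => {v | m ≤ agreeCount H (insert q A) (Function.update z q v)}
    with hUdef
  have hU : ∀ q, q ∉ A → (U q).card < g ^ e := by
    intro q hq
    have h1 : (U q).card * m ≤ agreeCount H A z := by
      refine le_trans ?_ (sum_agreeCount_insert_le H A z hq)
      rw [← smul_eq_mul]
      refine (card_nsmul_le_sum (U q) _ m fun v hv => ?_).trans
        (sum_le_sum_of_subset (subset_univ _))
      simpa [hUdef] using hv
    have h2 : m * (U q).card < m * g ^ e := by rw [mul_comm]; exact h1.trans_lt hz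
    exact Nat.lt_of_mul_lt_mul_left h2
  have hyU : ∀ y ∈ Z, ∀ q, q ∉ A → y q ∈ U q := by
    intro y hy q hq
    simp only [hUdef, mem_filter, mem_univ, true_and]
    refine ((hmem y hy).2.2 q hq).2.trans_eq (agreeCount_congr fun i hi => ?_)
    by_cases hiq : i = q
    · subst hiq; simp
    · rw [Function.update_of_ne hiq]
      exact (hmem y hy).1 i ((mem_insert.1 hi).resolve_left hiq)
  obtain ⟨q₀, hq₀⟩ : ∃ q, q ∉ A := by
    by_contra! h
    exact hA (eq_univ_iff_forall.2 h)
  set Φ : Finset (ι × (ι → V)) := {p ∈ H | p.1 ∉ A ∧ ∀ i ∈ A, p.2 i = z i} with hΦ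
  have hΦc : Φ.card = agreeCount H A z := rfl
  have hfacet : ∀ y ∈ Z, (q₀, Function.update y q₀ v₀) ∈ Φ := by
    intro y hy
    simp only [hΦ, mem_filter]
    refine ⟨((hmem y hy).2.2 q₀ hq₀).1, hq₀, fun i hi => ?_⟩
    rw [Function.update_of_ne (by rintro rfl; exact hq₀ hi)]
    exact (hmem y hy).1 i hi
  -- For e ≤ 6 a clique is determined by its facet at q₀, which is in Φ, and one of fewer than g^6
  -- popular values there.
  rcases he with he | ⟨rfl, he⟩
  · have hinj : Z.card ≤ (Φ ×ˢ U q₀).card := by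
      refine card_le_card_of_injOn (fun y => ((q₀, Function.update y q₀ v₀), y q₀))
        (fun y hy => mem_product.2 ⟨hfacet y hy, hyU y hy q₀ hq₀⟩) ?_
      intro y _ y' _ h
      simp only [Prod.mk.injEq, true_and] at h
      funext i
      by_cases hi : i = q₀
      · rw [hi, h.2]
      · have := congrFun h.1 i
        rwa [Function.update_of_ne hi, Function.update_of_ne hi] at this
    rw [card_product, hΦc, mul_comm] at hinj
    refine hinj.trans (Nat.mul_le_mul_right _ ?_)
    have := (hU q₀ hq₀).le.trans (Nat.pow_le_pow_right hg he)
    omega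
  · set R := Aᶜ.erase q₀ with hR
    have hRA : ∀ i, i ∈ R ↔ i ≠ q₀ ∧ i ∉ A := fun i => by simp [hR]
    have hRc : R.card = Aᶜ.card - 1 := card_erase_of_mem (by simpa using hq₀)
    -- The entry at q₀ is a popular value adjacent to all other hidden entries. Where fewer than g³
    -- such values exist, a facet extends in fewer than g³ ways.
    set C : (ι → V) → Finset V := fun y => {x ∈ U q₀ | ∀ i ∈ R, G.Adj (y i) x} with hC
    have hgood : #{y ∈ Z | (C y).card < g ^ 3} ≤ Φ.card * g ^ 3 := by
      have hsub : {y ∈ Z | (C y).card < g ^ 3} ⊆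
          ({p ∈ Φ | (C p.2).card < g ^ 3}).biUnion
            fun p => (C p.2).image fun x => Function.update p.2 q₀ x := by
        intro y hy
        obtain ⟨hy, hyc⟩ := mem_filter.1 hy
        have hCC : C (Function.update y q₀ v₀) = C y := by
          simp only [hC]
          refine filter_congr fun x _ => forall₂_congr fun i hi => ?_
          rw [Function.update_of_ne ((hRA i).1 hi).1]
        refine mem_biUnion.2 ⟨(q₀, Function.update y q₀ v₀), mem_filter.2 ⟨hfacet y hy, ?_⟩,
          mem_image.2 ⟨y q₀, ?_, ?_⟩⟩
        · rwa [hCC]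
        · rw [hCC]
          exact mem_filter.2 ⟨hyU y hy q₀ hq₀, fun i hi => (hmem y hy).2.1 i q₀ ((hRA i).1 hi).1⟩
        · simp
      refine (card_le_card hsub).trans (card_biUnion_le.trans ?_)
      refine (sum_le_card_nsmul _ _ (g ^ 3) fun p hp => ?_).trans ?_
      · exact card_image_le.trans (mem_filter.1 hp).2.le
      · rw [smul_eq_mul]
        exact Nat.mul_le_mul_right _ (card_filter_le _ _)
    have hbad : #{y ∈ Z | ¬ (C y).card < g ^ 3} ≤ Φ.card := by
      -- One clique of this class suffices to give m ≤ |Φ|. The whole class is then bounded by m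
      -- through the count of tuples with many common neighbours, without reference to the facets.
      rcases ({y ∈ Z | ¬ (C y).card < g ^ 3}).eq_empty_or_nonempty with h0 | ⟨y₁, hy₁⟩
      · rw [h0, card_empty]; exact Nat.zero_le _
      have h1 : m ≤ Φ.card := by
        have hy := (mem_filter.1 hy₁).1
        rw [hΦc, ← agreeCount_congr (hmem y₁ hy).1]
        exact ((hmem y₁ hy).2.2 q₀ hq₀).2.trans (agreeCount_insert_le H A y₁ hq₀)
      have hcount := card_many_common_neighbors_le G hg hG U R
        (fun i hi => (hU i ((hRA i).1 hi).2).le) z (U q₀)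
      have hinj : #{y ∈ Z | ¬ (C y).card < g ^ 3} ≤ (U q₀ ×ˢ
          ({y : ι → V | (∀ i, i ∉ R → y i = z i) ∧ (∀ i ∈ R, y i ∈ U i) ∧
            g ^ 3 ≤ #{x ∈ U q₀ | ∀ i ∈ R, G.Adj (y i) x}} : Finset (ι → V))).card := by
        refine card_le_card_of_injOn (fun y => (y q₀, Function.update y q₀ (z q₀))) ?_ ?_
        · intro y hy
          obtain ⟨hy, hyc⟩ := mem_filter.1 hy
          refine mem_product.2 ⟨hyU y hy q₀ hq₀, ?_⟩
          simp only [mem_filter, mem_univ, true_and]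
          refine ⟨fun i hi => ?_, fun i hi => ?_, ?_⟩
          · by_cases hiq : i = q₀
            · subst hiq; simp
            · rw [Function.update_of_ne hiq]
              refine (hmem y hy).1 i ?_
              by_contra hiA
              exact hi ((hRA i).2 ⟨hiq, hiA⟩)
          · rw [Function.update_of_ne ((hRA i).1 hi).1]
            exact hyU y hy i ((hRA i).1 hi).2
          · refine (not_lt.1 hyc).trans_eq ?_
            simp only [hC]
            congr 1
            refine filter_congr fun x _ => forall₂_congr fun i hi => ?_
            rw [Function.update_of_ne ((hRA i).1 hi).1]
        · intro y _ y' _ h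
          simp only [Prod.mk.injEq] at h
          funext i
          by_cases hi : i = q₀
          · rw [hi, h.1]
          · have := congrFun h.2 i
            rwa [Function.update_of_ne hi, Function.update_of_ne hi] at this
      rw [card_product] at hinj
      refine hinj.trans (le_trans ?_ (he.trans h1))
      have hUc := (hU q₀ hq₀).le
      calc _ ≤ g ^ e * (g ^ (3 * R.card) * (g ^ e) ^ e) :=
            Nat.mul_le_mul hUc (hcount.trans (Nat.mul_le_mul_left _ (Nat.pow_le_pow_left hUc e)))
        _ = g ^ (e + 3 * (Aᶜ.card - 1) + e * e) := by rw [hRc]; ring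
    have hsplit := card_filter_add_card_filter_not (s := Z) (fun y => (C y).card < g ^ 3)
    have h36 : g ^ 3 ≤ g ^ 6 := Nat.pow_le_pow_right hg (by norm_num)
    have : Φ.card * g ^ 3 ≤ Φ.card * g ^ 6 := Nat.mul_le_mul_left _ h36
    rw [← hsplit, ← hΦc]
    calc _ ≤ Φ.card * g ^ 6 + Φ.card := by omega
      _ = (g ^ 6 + 1) * Φ.card := by ring

/-- In a locally sparse graph, a small set `H` of facets contains many facets of only few cliques. -/
theorem card_clique_many_facets_le {g a j : ℕ} (hg : 0 < g)
    (hG : ∀ W : Finset V, g ^ 3 ≤ W.card → #{v | W.card ≤ g * #{x ∈ W | G.Adj v x}} < g ^ 3)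
    (M : ℕ → ℕ) (hM0 : M 0 = 0) (hM1 : M 1 = 1) (hmono : Monotone M)
    (hstep : ∀ s, 2 ≤ s → s ≤ Fintype.card ι → M s ≤ M (s - 1) * g ^ 6 ∨
      M s ≤ M (s - 1) * g ^ a ∧ g ^ (a + 3 * (s - 1) + a * a) ≤ M (s - 1))
    (H : Finset (ι × (ι → V))) (hH : H.card < M j) (v₀ : V) :
    #{y : ι → V | (∀ p q, p ≠ q → G.Adj (y p) (y q)) ∧
        j ≤ #{p | (p, Function.update y p v₀) ∈ H}} ≤
      2 ^ Fintype.card ι * ((g ^ 6 + 1) * H.card) := by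
  set Z : Finset ι → Finset (ι → V) := fun A => {y | 2 ≤ Aᶜ.card ∧ agreeCount H A y < M Aᶜ.card ∧
    (∀ p q, p ≠ q → G.Adj (y p) (y q)) ∧ ∀ q, q ∉ A → (q, Function.update y q v₀) ∈ H ∧
      M (Aᶜ.card - 1) ≤ agreeCount H (insert q A) y} with hZ
  have hcover : ({y : ι → V | (∀ p q, p ≠ q → G.Adj (y p) (y q)) ∧
      j ≤ #{p | (p, Function.update y p v₀) ∈ H}} : Finset (ι → V)) ⊆ univ.biUnion Z := by
    intro y hy
    simp only [mem_filter, mem_univ, true_and] at hy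
    obtain ⟨hcl, hj⟩ := hy
    set P : Finset ι := {p | (p, Function.update y p v₀) ∈ H} with hP
    have hPm : ∀ p, p ∈ P ↔ (p, Function.update y p v₀) ∈ H := fun p => by simp [hP]
    -- All positions whose facet is not in H are exposed from the start; the at least j others make
    -- the initial set admissible because |H| < M j. Maximality of A yields the lower bounds on
    -- further extensions.
    obtain ⟨A, hA, hmax⟩ := exists_max_image
      ({A : Finset ι | Pᶜ ⊆ A ∧ agreeCount H A y < M Aᶜ.card}) Finset.card
      ⟨Pᶜ, by
        simp only [mem_filter, mem_univ, true_and, compl_compl]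
        exact ⟨Subset.rfl, (agreeCount_le_card _ _ _).trans_lt (hH.trans_le (hmono hj))⟩⟩
    simp only [mem_filter, mem_univ, true_and] at hA
    obtain ⟨hPA, hAM⟩ := hA
    have hout : ∀ q, q ∉ A → (q, Function.update y q v₀) ∈ H := fun q hq => by
      rw [← hPm]
      by_contra h
      exact hq (hPA (mem_compl.2 h))
    refine mem_biUnion.2 ⟨A, mem_univ _, ?_⟩
    simp only [hZ, mem_filter, mem_univ, true_and]
    refine ⟨?_, hAM, hcl, fun q hq => ⟨hout q hq, ?_⟩⟩
    -- M 0 = 0 excludes that everything is exposed. M 1 = 1 excludes one hidden coordinate, as the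
    -- clique's own facet there is counted.
    · by_contra! hlt
      have h0 : Aᶜ.card ≠ 0 := fun h => by rw [h, hM0] at hAM; omega
      have h1 : Aᶜ.card = 1 := by omega
      rw [h1, hM1] at hAM
      obtain ⟨q, hq⟩ := card_pos.1 (show 0 < Aᶜ.card by omega)
      have hq' : q ∉ A := by simpa using hq
      have : 0 < agreeCount H A y := card_pos.2 ⟨(q, Function.update y q v₀), by
        refine mem_filter.2 ⟨hout q hq', hq', fun i hi => ?_⟩
        exact Function.update_of_ne (ne_of_mem_of_not_mem hi hq') _ _⟩
      omega
    · by_contra! hlt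
      have hc : (insert q A)ᶜ.card = Aᶜ.card - 1 := by
        rw [card_compl, card_compl, card_insert_of_notMem hq]; omega
      have := hmax (insert q A) (by
        simp only [mem_filter, mem_univ, true_and]
        exact ⟨hPA.trans (subset_insert _ _), by rwa [hc]⟩)
      rw [card_insert_of_notMem hq] at this
      omega
  have hZc : ∀ A, (Z A).card ≤ (g ^ 6 + 1) * H.card := by
    intro A
    rcases (Z A).eq_empty_or_nonempty with h0 | ⟨y₁, hy₁⟩
    · rw [h0, card_empty]; exact Nat.zero_le _
    have hA2 : 2 ≤ Aᶜ.card := by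
      simp only [hZ, mem_filter, mem_univ, true_and] at hy₁
      exact hy₁.1
    have hAu : A ≠ univ := by rintro rfl; simp at hA2
    -- The cliques are grouped by their entries on A, with v₀ as a filler elsewhere.
    set ρ : (ι → V) → (ι → V) := fun y i => if i ∈ A then y i else v₀ with hρ
    have hagree : ∀ y, agreeCount H A (ρ y) = agreeCount H A y := fun y =>
      agreeCount_congr fun i hi => by simp [hρ, hi]
    have hfib : ∀ z ∈ (Z A).image ρ, #{y ∈ Z A | ρ y = z} ≤ (g ^ 6 + 1) * agreeCount H A z := by
      intro z hz
      obtain ⟨y₂, hy₂, rfl⟩ := mem_image.1 hz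
      simp only [hZ, mem_filter, mem_univ, true_and] at hy₂
      have hlt : agreeCount H A (ρ y₂) < M Aᶜ.card := by rw [hagree]; exact hy₂.2.1
      have hsub : {y ∈ Z A | ρ y = ρ y₂} ⊆ ({y : ι → V | (∀ i ∈ A, y i = ρ y₂ i) ∧
          (∀ i j, i ≠ j → G.Adj (y i) (y j)) ∧ ∀ q, q ∉ A → (q, Function.update y q v₀) ∈ H ∧
            M (Aᶜ.card - 1) ≤ agreeCount H (insert q A) y} : Finset (ι → V)) := by
        intro y hy
        simp only [hZ, mem_filter, mem_univ, true_and] at hy ⊢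
        refine ⟨fun i hi => ?_, hy.1.2.2⟩
        rw [← hy.2]
        simp [hρ, hi]
      refine (card_le_card hsub).trans ?_
      rcases hstep _ hA2 (card_le_univ _) with h | ⟨h, h'⟩
      · exact card_clique_fiber_le (a := a) G hg hG H A hAu v₀ _ (hlt.trans_le h)
          (.inl le_rfl)
      · exact card_clique_fiber_le (a := a) G hg hG H A hAu v₀ _ (hlt.trans_le h)
          (.inr ⟨rfl, h'⟩)
    rw [card_eq_sum_card_image ρ (Z A)]
    refine (sum_le_sum hfib).trans ?_
    rw [← mul_sum]
    refine Nat.mul_le_mul_left _ ?_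
    -- Each pair in H agrees with only one group, so the counts sum to at most |H|.
    calc _ ≤ ∑ z ∈ (Z A).image ρ, #{p ∈ H | ρ p.2 = z} := by
          refine sum_le_sum fun z hz => card_le_card fun p hp => ?_
          obtain ⟨y, -, rfl⟩ := mem_image.1 hz
          simp only [mem_filter] at hp ⊢
          refine ⟨hp.1, funext fun i => ?_⟩
          by_cases hi : i ∈ A
          · have := hp.2.2 i hi
            simpa [hρ, hi] using this
          · simp [hρ, hi]
      _ ≤ H.card := by
          rw [← card_biUnion]
          · exact card_le_card (biUnion_subset.2 fun z _ => filter_subset _ _)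
          · intro z _ z' _ hzz
            refine disjoint_left.2 fun p hp hp' => hzz ?_
            rw [← (mem_filter.1 hp).2, (mem_filter.1 hp').2]
  refine (card_le_card hcover).trans (card_biUnion_le.trans ?_)
  refine (sum_le_card_nsmul _ _ _ fun A _ => hZc A).trans ?_
  simp

end

section

open Finset
open scoped Classical

/-! ### Counting edges by ordered pairs -/

/-- An orientation towards larger numbers represents each edge by exactly one ordered pair. -/
theorem ncard_edgeSet_induce {N : ℕ} (G : SimpleGraph (Fin N)) (r : Fin N → Fin N → Prop)
    [∀ x y, Decidable (r x y)] (hr : ∀ x y, G.Adj x y ↔ r x y ∨ r y x) (hlt : ∀ x y, r x y → x < y) (S : Finset (Fin N)) :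
    (G.induce (S : Set (Fin N))).edgeSet.ncard = #{p ∈ S ×ˢ S | r p.1 p.2} := by
  rw [← Set.ncard_image_of_injective _ (Sym2.map.injective Subtype.val_injective),
    ← Set.ncard_coe_finset]
  have himg : Sym2.map Subtype.val '' (G.induce (S : Set (Fin N))).edgeSet =
      (fun p : Fin N × Fin N => s(p.1, p.2)) '' ({p ∈ S ×ˢ S | r p.1 p.2} : Finset _) := by
    ext e
    constructor
    · rintro ⟨e, he, rfl⟩
      induction e with
      | _ x y =>
        rw [SimpleGraph.mem_edgeSet, SimpleGraph.comap_adj] at he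
        rcases (hr _ _).1 he with h | h
        · exact ⟨(x, y), by simpa using h, rfl⟩
        · exact ⟨(y, x), by simpa using h, Sym2.eq_swap⟩
    · rintro ⟨⟨x, y⟩, hp, rfl⟩
      simp only [coe_filter, mem_product, Set.mem_ofPred_eq] at hp
      exact ⟨s(⟨x, hp.1.1⟩, ⟨y, hp.1.2⟩), (hr x y).2 (.inl hp.2), rfl⟩
  rw [himg]
  refine Set.InjOn.ncard_image ?_
  rintro ⟨x, y⟩ hp ⟨x', y'⟩ hp' h
  simp only [coe_filter, mem_product, Set.mem_ofPred_eq] at hp hp'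
  rcases Sym2.eq_iff.1 h with ⟨rfl, rfl⟩ | ⟨rfl, rfl⟩
  · rfl
  · exact absurd (hlt _ _ hp.2) (hlt _ _ hp'.2).asymm

theorem density_eq {N : ℕ} (G : SimpleGraph (Fin N)) (r : Fin N → Fin N → Prop)
    [∀ x y, Decidable (r x y)] (hr : ∀ x y, G.Adj x y ↔ r x y ∨ r y x) (hlt : ∀ x y, r x y → x < y) (S : Finset (Fin N)) :
    density G S = (#{p ∈ S ×ˢ S | r p.1 p.2} : ℝ) / S.card := by
  rw [density, ncard_edgeSet_induce G r hr hlt]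

theorem card_adj_pairs {N : ℕ} (G : SimpleGraph (Fin N)) (S : Finset (Fin N)) :
    #{p ∈ S ×ˢ S | G.Adj p.1 p.2} = 2 * #{p ∈ S ×ˢ S | p.1 < p.2 ∧ G.Adj p.1 p.2} := by
  have hsplit := card_filter_add_card_filter_not (s := {p ∈ S ×ˢ S | G.Adj p.1 p.2})
    (fun p => p.1 < p.2)
  rw [filter_filter, filter_filter] at hsplit
  have h1 : #{p ∈ S ×ˢ S | G.Adj p.1 p.2 ∧ p.1 < p.2} =
      #{p ∈ S ×ˢ S | p.1 < p.2 ∧ G.Adj p.1 p.2} := by simp only [and_comm]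
  have h2 : #{p ∈ S ×ˢ S | G.Adj p.1 p.2 ∧ ¬ p.1 < p.2} =
      #{p ∈ S ×ˢ S | p.1 < p.2 ∧ G.Adj p.1 p.2} := by
    refine card_bij (fun p _ => p.swap) ?_ (fun _ _ _ _ h => Prod.swap_injective h) ?_
    · rintro ⟨x, y⟩ h
      simp only [mem_filter, mem_product, Prod.swap] at h ⊢
      exact ⟨h.1.symm, lt_of_le_of_ne (not_lt.1 h.2.2) h.2.1.ne', h.2.1.symm⟩
    · rintro ⟨x, y⟩ h
      simp only [mem_filter, mem_product] at h
      refine ⟨(y, x), ?_, rfl⟩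
      simp only [mem_filter, mem_product]
      exact ⟨h.1.symm, h.2.2.symm, h.2.1.asymm⟩
  omega

/-- The local sparsity in the soundness case. -/
theorem PolyGapDkS.Soundness.card_adj_pairs_le {n k g : ℕ} {δ : ℝ} {G : SimpleGraph (Fin n)}
    (h : PolyGapDkS.Soundness δ G k) (hg : (k : ℝ) ^ δ ≤ 2 * g) (S : Finset (Fin n))
    (hS : S.card ≤ k) : #{p ∈ S ×ˢ S | G.Adj p.1 p.2} ≤ 4 * g * S.card := by
  rcases S.eq_empty_or_nonempty with rfl | hne
  · simp
  have h1 := h S hS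
  rw [density_eq G (fun x y => x < y ∧ G.Adj x y) (fun x y => by
    constructor
    · intro hxy
      rcases lt_or_gt_of_ne hxy.ne with h | h
      · exact .inl ⟨h, hxy⟩
      · exact .inr ⟨h, hxy.symm⟩
    · rintro (⟨-, h⟩ | ⟨-, h⟩)
      · exact h
      · exact h.symm) (fun x y h => h.1)] at h1
  have hpos : (0 : ℝ) < S.card := by exact_mod_cast hne.card_pos
  rw [div_lt_iff₀ hpos] at h1
  have h2 := h1.le.trans (mul_le_mul_of_nonneg_right hg hpos.le)
  have h3 : #{p ∈ S ×ˢ S | p.1 < p.2 ∧ G.Adj p.1 p.2} ≤ 2 * g * S.card := by exact_mod_cast h2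
  rw [card_adj_pairs]
  calc _ ≤ 2 * (2 * g * S.card) := Nat.mul_le_mul_left _ h3
    _ = _ := by ring

/-! ### Tuples and their facets -/

section

variable {V : Type*} [Fintype V] (G : SimpleGraph V)

/-- The thresholds for the number of facets in the choice of the exposed coordinates. -/
def facetThreshold (g a s : ℕ) : ℕ := if s = 0 then 0 else g ^ (6 * (s - 1) + (a - 6) * (s - a * a))

theorem facetThreshold_mono {g : ℕ} (hg : 0 < g) (a : ℕ) : Monotone (facetThreshold g a) := by
  intro s s' h
  unfold facetThreshold
  split_ifs
  · rfl
  · exact Nat.zero_le _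
  · omega
  · refine Nat.pow_le_pow_right hg (Nat.add_le_add (by omega) (Nat.mul_le_mul_left _ (by omega)))

/-- The thresholds grow by g^6 up to s = a² and by g^a afterwards. The slow phase makes them large
enough to absorb the error term g^(a + 3(s-1) + a²), whose exponent gains only 3 per coordinate. -/
theorem facetThreshold_step {g a s : ℕ} (hg : 0 < g) (ha : 6 ≤ a) (hs : 2 ≤ s) :
    facetThreshold g a s ≤ facetThreshold g a (s - 1) * g ^ 6 ∨
      facetThreshold g a s ≤ facetThreshold g a (s - 1) * g ^ a ∧
        g ^ (a + 3 * (s - 1) + a * a) ≤ facetThreshold g a (s - 1) := by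
  unfold facetThreshold
  rw [if_neg (by omega), if_neg (by omega), ← pow_add, ← pow_add]
  rcases Nat.lt_or_ge (a * a) s with h | h
  · right
    obtain ⟨d, rfl⟩ := Nat.exists_eq_add_of_lt h
    have h1 : a * a + d + 1 - a * a = d + 1 := by omega
    have h2 : a * a + d + 1 - 1 - a * a = d := by omega
    rw [h1, h2]
    have h3 : (a - 6) * (d + 1) = (a - 6) * d + (a - 6) := by ring
    have h4 : 6 * a ≤ a * a := Nat.mul_le_mul_right _ ha
    constructor <;> refine Nat.pow_le_pow_right hg ?_ <;> omega
  · left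
    refine Nat.pow_le_pow_right hg ?_
    have h1 : s - a * a = 0 := by omega
    have h2 : s - 1 - a * a = 0 := by omega
    rw [h1, h2]
    omega

theorem card_clique_many_removeNth_le {g a d j : ℕ} (hg : 0 < g) (ha : 6 ≤ a)
    (hG : ∀ W : Finset V, g ^ 3 ≤ W.card → #{v | W.card ≤ g * #{x ∈ W | G.Adj v x}} < g ^ 3)
    (F : Finset (Fin d → V)) (hF : (d + 1) * F.card < facetThreshold g a j) :
    #{y : Fin (d + 1) → V | (∀ p q, p ≠ q → G.Adj (y p) (y q)) ∧
        j ≤ #{p : Fin (d + 1) | p.removeNth (α := fun _ => V) y ∈ F}} ≤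
      2 ^ (d + 1) * ((g ^ 6 + 1) * ((d + 1) * F.card)) := by
  rcases isEmpty_or_nonempty V with hV | ⟨⟨v₀⟩⟩
  · rw [card_eq_zero.2]
    · exact Nat.zero_le _
    · exact filter_eq_empty_iff.2 fun y => (hV.false (y 0)).elim
  -- A facet is padded with v₀ to a full tuple and the padded position is recorded, which costs the
  -- factor d + 1.
  set H : Finset (Fin (d + 1) × (Fin (d + 1) → V)) :=
    (univ ×ˢ F).image fun x => (x.1, x.1.insertNth (α := fun _ => V) v₀ x.2) with hH
  have hHc : H.card ≤ (d + 1) * F.card := card_image_le.trans (by simp)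
  have h := card_clique_many_facets_le G (a := a) hg hG (facetThreshold g a) (by simp [facetThreshold])
    (by simp [facetThreshold, Nat.sub_eq_zero_of_le (show 1 ≤ a * a by nlinarith)]) (facetThreshold_mono hg a)
    (fun s hs _ => facetThreshold_step hg ha hs) H (hHc.trans_lt hF) v₀
  rw [Fintype.card_fin] at h
  refine le_trans (card_le_card fun y hy => ?_) (h.trans (by gcongr))
  simp only [mem_filter, mem_univ, true_and] at hy ⊢
  refine ⟨hy.1, hy.2.trans (card_le_card fun p hp => ?_)⟩
  simp only [mem_filter, mem_univ, true_and] at hp ⊢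
  refine mem_image.2 ⟨(p, p.removeNth y), by simpa using hp, ?_⟩
  exact Prod.ext rfl ((Fin.insertNth_removeNth p v₀ y).trans (by congr!))

/-- The number of incidences between cliques and a small set of facets. -/
theorem sum_card_removeNth_le {g a d j : ℕ} (hg : 0 < g) (ha : 6 ≤ a)
    (hG : ∀ W : Finset V, g ^ 3 ≤ W.card → #{v | W.card ≤ g * #{x ∈ W | G.Adj v x}} < g ^ 3)
    (F : Finset (Fin d → V)) (hF : (d + 1) * F.card < facetThreshold g a j)
    (Y : Finset (Fin (d + 1) → V)) (hY : ∀ y ∈ Y, ∀ p q, p ≠ q → G.Adj (y p) (y q)) :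
    ∑ y ∈ Y, #{p : Fin (d + 1) | p.removeNth (α := fun _ => V) y ∈ F} ≤
      j * Y.card + (d + 1) ^ 2 * 2 ^ (d + 1) * (g ^ 6 + 1) * F.card := by
  -- A typical clique has fewer than j facets in F; an exceptional one is charged all d + 1.
  rw [← sum_filter_add_sum_filter_not Y (fun y => j ≤ #{p : Fin (d + 1) | p.removeNth (α := fun _ => V) y ∈ F}),
    add_comm]
  refine add_le_add ?_ ?_
  · refine (sum_le_card_nsmul _ _ j fun y hy => ?_).trans ?_
    · exact (not_le.1 (mem_filter.1 hy).2).le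
    · rw [smul_eq_mul, mul_comm]
      exact Nat.mul_le_mul_left _ (card_filter_le _ _)
  · refine (sum_le_card_nsmul _ _ (d + 1) fun y hy => ?_).trans ?_
    · exact (card_le_univ _).trans (by simp)
    · rw [smul_eq_mul]
      have h1 : #{y ∈ Y | j ≤ #{p : Fin (d + 1) | p.removeNth (α := fun _ => V) y ∈ F}} ≤ _ :=
        (card_le_card fun y hy => by
          simp only [mem_filter, mem_univ, true_and] at hy ⊢
          exact ⟨hY y hy.1, hy.2⟩).trans (card_clique_many_removeNth_le G hg ha hG F hF)
      calc _ ≤ _ := Nat.mul_le_mul_right _ h1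
        _ = _ := by ring

end

/-!
# The graph of cliques and facets

Its vertices are numbers: the tuples of length `d + 1` over `Fin n`, then `w` copies of the tuples of
length `d`, then the two sides of a complete bipartite graph.
-/

namespace CliqueFacetGraph

/-- The digit of `x` at position `i` in base `n`. -/
def digit (n x i : ℕ) : ℕ := x / n ^ i % n

/-- The number whose digits in base `n` are the entries of the tuple. -/
def tupleIndex {m n : ℕ} (v : Fin m → Fin n) : ℕ := (finFunctionFinEquiv v : ℕ)

/-- The end of the block of facets. -/
def facetEnd (d n w : ℕ) : ℕ := n ^ (d + 1) + n ^ d * w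

/-- The end of the left side of the complete bipartite graph. -/
def leftEnd (d n k w : ℕ) : ℕ := facetEnd d n w + k ^ d * w

/-- The number of vertices. -/
def order (d n k w : ℕ) : ℕ := leftEnd d n k w + (d + 1) ^ 2 * w

/-- The size threshold of the instance. -/
def threshold (d k w : ℕ) : ℕ := (d + 1) * (k ^ d * w)

/-- The tuple with index `x` is a clique, and `y` is a copy of one of its facets. -/
def Incident (d n w : ℕ) (adj : ℕ → ℕ → Prop) (x y : ℕ) : Prop :=
  (x < n ^ (d + 1) ∧ n ^ (d + 1) ≤ y ∧ y < facetEnd d n w) ∧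
    (∀ p q : Fin (d + 1), p ≠ q → adj (digit n x p) (digit n x q)) ∧
      ∃ p : Fin (d + 1), ∀ i : Fin d,
        digit n (y - n ^ (d + 1)) i = digit n x (p.succAbove i : Fin (d + 1))

/-- Edges, directed from the smaller to the larger vertex. -/
def Arc (d n k w : ℕ) (adj : ℕ → ℕ → Prop) (x y : ℕ) : Prop :=
  Incident d n w adj x y ∨
    (facetEnd d n w ≤ x ∧ x < leftEnd d n k w) ∧ leftEnd d n k w ≤ y ∧ y < order d n k w

theorem Arc.lt {d n k w : ℕ} {adj : ℕ → ℕ → Prop} {x y : ℕ} (h : Arc d n k w adj x y) : x < y := by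
  rcases h with h | h
  · exact h.1.1.trans_le h.1.2.1
  · exact h.1.2.trans_le h.2.1

/-- The adjacency of a graph on `Fin n` as a relation on numbers. -/
def natAdj {n : ℕ} (G : SimpleGraph (Fin n)) (x y : ℕ) : Prop :=
  ∃ (hx : x < n) (hy : y < n), G.Adj ⟨x, hx⟩ ⟨y, hy⟩

/-! ### Indices -/

theorem tupleIndex_lt {m n : ℕ} (v : Fin m → Fin n) : tupleIndex v < n ^ m :=
  (finFunctionFinEquiv v).isLt

theorem tupleIndex_injective {m n : ℕ} :
    Function.Injective (tupleIndex : (Fin m → Fin n) → ℕ) := fun _ _ h =>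
  finFunctionFinEquiv.injective (Fin.ext h)

theorem exists_tupleIndex_eq {m n x : ℕ} (h : x < n ^ m) : ∃ v : Fin m → Fin n, tupleIndex v = x :=
  ⟨finFunctionFinEquiv.symm ⟨x, h⟩, by simp [tupleIndex]⟩

theorem digit_tupleIndex {m n : ℕ} (v : Fin m → Fin n) (i : Fin m) :
    digit n (tupleIndex v) i = v i := by
  have h : finFunctionFinEquiv.symm (finFunctionFinEquiv v) i = v i := by simp
  rw [← h]
  rfl

/-- The copy number is stored above the d digits of a facet, so those digits are the same in all
copies. -/
theorem digit_add {n d i j x : ℕ} (hn : 0 < n) (hi : i < d) :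
    digit n (j * n ^ d + x) i = digit n x i := by
  obtain ⟨c, rfl⟩ := Nat.exists_eq_add_of_lt hi
  unfold digit
  have h : j * n ^ (i + c + 1) + x = x + n ^ i * (j * n ^ c * n) := by ring
  rw [h, Nat.add_mul_div_left _ _ (pow_pos hn i), Nat.add_mul_mod_self_right]

/-- The vertex that is the copy number `i` of the facet `f`. -/
def facetIndex {d n : ℕ} (i : ℕ) (f : Fin d → Fin n) : ℕ := n ^ (d + 1) + (i * n ^ d + tupleIndex f)

theorem facetIndex_inj {d n i i' : ℕ} {f f' : Fin d → Fin n}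
    (h : facetIndex i f = facetIndex i' f') : i = i' ∧ f = f' := by
  have h1 : i * n ^ d + tupleIndex f = i' * n ^ d + tupleIndex f' := by
    unfold facetIndex at h; omega
  have hf := tupleIndex_lt f
  have hf' := tupleIndex_lt f'
  have hpos : 0 < n ^ d := by omega
  have h2 : i = i' := by
    have := congrArg (· / n ^ d) h1
    simpa [Nat.mul_add_div, mul_comm _ (n ^ d), Nat.mul_add_div hpos, Nat.div_eq_of_lt hf,
      Nat.div_eq_of_lt hf'] using this
  subst h2
  exact ⟨rfl, tupleIndex_injective (by omega)⟩

theorem facetIndex_lt {d n w i : ℕ} (hi : i < w) (f : Fin d → Fin n) :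
    facetIndex i f < facetEnd d n w := by
  have hf := tupleIndex_lt f
  have : (i + 1) * n ^ d ≤ w * n ^ d := Nat.mul_le_mul_right _ hi
  unfold facetIndex facetEnd
  rw [mul_comm (n ^ d)]
  nlinarith

theorem incident_iff {d n w : ℕ} (G : SimpleGraph (Fin n)) {x y : ℕ} :
    Incident d n w (natAdj G) x y ↔ ∃ (v : Fin (d + 1) → Fin n) (i : ℕ) (p : Fin (d + 1)),
      (∀ p q, p ≠ q → G.Adj (v p) (v q)) ∧ i < w ∧ x = tupleIndex v ∧
        y = facetIndex i (p.removeNth (α := fun _ => Fin n) v) := by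
  have hadj : ∀ (v : Fin (d + 1) → Fin n) (p q : Fin (d + 1)),
      natAdj G (digit n (tupleIndex v) p) (digit n (tupleIndex v) q) ↔ G.Adj (v p) (v q) := by
    intro v p q
    simp [digit_tupleIndex, natAdj]
  constructor
  · rintro ⟨⟨hx, hy, hy'⟩, hcl, p, hp⟩
    obtain ⟨v, rfl⟩ := exists_tupleIndex_eq hx
    have hn : 0 < n := (v 0).pos
    have hz : y - n ^ (d + 1) < w * n ^ d := by
      unfold facetEnd at hy'
      rw [mul_comm w]
      omega
    obtain ⟨f, hf⟩ := exists_tupleIndex_eq (Nat.mod_lt (y - n ^ (d + 1)) (pow_pos hn d))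
    have hyz : y - n ^ (d + 1) = (y - n ^ (d + 1)) / n ^ d * n ^ d + tupleIndex f := by
      rw [hf, Nat.div_add_mod']
    refine ⟨v, (y - n ^ (d + 1)) / n ^ d, p, fun p q hpq => (hadj v p q).1 (hcl p q hpq),
      Nat.div_lt_of_lt_mul (by rwa [mul_comm]), rfl, ?_⟩
    have hfv : p.removeNth (α := fun _ => Fin n) v = f := by
      funext i
      have := hp i
      rw [hyz, digit_add hn i.isLt, digit_tupleIndex, digit_tupleIndex] at this
      exact (Fin.ext this).symm
    rw [hfv]
    unfold facetIndex
    omega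
  · rintro ⟨v, i, p, hcl, hi, rfl, rfl⟩
    have hn : 0 < n := (v 0).pos
    refine ⟨⟨tupleIndex_lt v, Nat.le_add_right _ _, facetIndex_lt hi _⟩,
      fun p q hpq => (hadj v p q).2 (hcl p q hpq), p, fun q => ?_⟩
    rw [facetIndex, Nat.add_sub_cancel_left, digit_add hn q.isLt, digit_tupleIndex,
      digit_tupleIndex]
    rfl

/-! ### Counting edges inside a set -/

variable {d n k w : ℕ} (G : SimpleGraph (Fin n)) (S : Finset ℕ)

/-- The number of edges inside `S`. -/
noncomputable def arcCount (d n k w : ℕ) (adj : ℕ → ℕ → Prop) (S : Finset ℕ) : ℕ :=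
  #{p ∈ S ×ˢ S | Arc d n k w adj p.1 p.2}

/-- The cliques in `S`. -/
noncomputable def cliquesIn (d : ℕ) : Finset (Fin (d + 1) → Fin n) :=
  {v | (∀ p q, p ≠ q → G.Adj (v p) (v q)) ∧ tupleIndex v ∈ S}

variable {G S} in
theorem mem_cliquesIn {v : Fin (d + 1) → Fin n} :
    v ∈ cliquesIn G S d ↔ (∀ p q, p ≠ q → G.Adj (v p) (v q)) ∧ tupleIndex v ∈ S := by
  simp [cliquesIn]

/-- The facets whose copy number `i` is in `S`. -/
noncomputable def facetsIn (d n i : ℕ) : Finset (Fin d → Fin n) := {f | facetIndex i f ∈ S}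

theorem card_cliquesIn_le : (cliquesIn G S d).card ≤ S.card :=
  card_le_card_of_injOn tupleIndex (fun v hv => by
    have := (mem_filter.1 hv).2
    exact this.2) tupleIndex_injective.injOn

theorem sum_card_facetsIn_le : ∑ i ∈ range w, (facetsIn S d n i).card ≤ S.card := by
  rw [← card_sigma]
  refine card_le_card_of_injOn (fun x : (_ : ℕ) × (Fin d → Fin n) => facetIndex x.1 x.2)
    (fun x hx => ?_) ?_
  · have := (mem_sigma.1 hx).2
    simpa [facetsIn] using this
  · rintro ⟨i, f⟩ _ ⟨i', f'⟩ _ h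
    obtain ⟨rfl, rfl⟩ := facetIndex_inj h
    rfl

/-- The first term is the number of all edges of the bipartite part, (k^d w)((d+1)² w). Every other
edge comes from a copy number, a clique and a deleted position. -/
theorem arcCount_le : arcCount d n k w (natAdj G) S ≤ (d + 1) * w * threshold d k w +
    ∑ i ∈ range w, ∑ v ∈ cliquesIn G S d,
      #{p : Fin (d + 1) | p.removeNth (α := fun _ => Fin n) v ∈ facetsIn S d n i} := by
  have hsub : {p ∈ S ×ˢ S | Arc d n k w (natAdj G) p.1 p.2} ⊆
      (Ico (facetEnd d n w) (leftEnd d n k w) ×ˢ Ico (leftEnd d n k w) (order d n k w)) ∪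
      ((range w ×ˢ cliquesIn G S d).sigma fun x =>
        {p : Fin (d + 1) | p.removeNth (α := fun _ => Fin n) x.2 ∈ facetsIn S d n x.1}).image
        fun x => (tupleIndex x.1.2,
          facetIndex x.1.1 (x.2.removeNth (α := fun _ => Fin n) x.1.2)) := by
    rintro ⟨x, y⟩ h
    obtain ⟨h1, h | h⟩ := mem_filter.1 h
    · obtain ⟨hx, hy⟩ := mem_product.1 h1
      obtain ⟨v, i, p, hcl, hi, rfl, rfl⟩ := (incident_iff G).1 h
      refine mem_union_right _ (mem_image.2 ⟨⟨(i, v), p⟩, ?_, rfl⟩)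
      simp only [mem_sigma, mem_product, mem_range, cliquesIn, facetsIn, mem_filter, mem_univ,
        true_and]
      exact ⟨⟨hi, hcl, hx⟩, hy⟩
    · exact mem_union_left _ (mem_product.2 ⟨mem_Ico.2 h.1, mem_Ico.2 h.2⟩)
  refine (card_le_card hsub).trans ((card_union_le _ _).trans (add_le_add ?_ ?_))
  · rw [card_product, Nat.card_Ico, Nat.card_Ico, leftEnd, order, leftEnd,
      Nat.add_sub_cancel_left, Nat.add_sub_cancel_left, threshold]
    exact le_of_eq (by ring)
  · refine card_image_le.trans (le_of_eq ?_)
    rw [card_sigma, sum_product]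

end CliqueFacetGraph

/-- With t! ≤ g, the constants of the clique count are absorbed by the one factor g that w = g^7 has
in excess of g^6. -/
theorem Nat.sq_mul_two_pow_le_factorial {t : ℕ} (ht : 10 ≤ t) :
    t ^ 2 * 2 ^ (t + 1) ≤ t.factorial := by
  induction t, ht using Nat.le_induction with
  | base => decide
  | succ t ht ih =>
    rw [Nat.factorial_succ]
    calc (t + 1) ^ 2 * 2 ^ (t + 1 + 1) = (t + 1) * ((2 * (t + 1)) * 2 ^ (t + 1)) := by ring
      _ ≤ (t + 1) * (t ^ 2 * 2 ^ (t + 1)) := by gcongr; nlinarith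
      _ ≤ _ := by gcongr

/-! ### Densities in the soundness and completeness cases -/

namespace CliqueFacetGraph

variable {d n k : ℕ} (G : SimpleGraph (Fin n))

/-- This fixes the constants. Since k < (g+1)^10 ≤ g^20, the left side is at most g^(3 + 20t).
Because a · a² = 21 a² u = 21t, the threshold at 2a² has exponent 21t + 6a² - 6. -/
theorem facetThreshold_large {u a d g k : ℕ} (hu : 1 ≤ u) (ha : a = 21 * u)
    (hd : d + 1 = a * a * u) (hg : d + 1 ≤ g) (hkg : k < (g + 1) ^ 10) :
    (d + 1) ^ 3 * k ^ (d + 1) < facetThreshold g a (2 * (a * a)) := by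
  have ha21 : 21 ≤ a := by omega
  have hA : 441 ≤ a * a := Nat.mul_le_mul ha21 ha21
  have hAu : a * a ≤ a * a * u := Nat.le_mul_of_pos_right _ hu
  have hk : k ≤ g ^ 20 := by
    refine hkg.le.trans ?_
    calc (g + 1) ^ 10 ≤ (g * g) ^ 10 := Nat.pow_le_pow_left (by nlinarith) _
      _ = _ := by ring
  have h1 : (d + 1) ^ 3 * k ^ (d + 1) ≤ g ^ (3 + 20 * (d + 1)) := by
    rw [pow_add g, pow_mul]
    gcongr
  refine h1.trans_lt ?_
  unfold facetThreshold
  rw [if_neg (by omega)]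
  refine Nat.pow_lt_pow_right (by omega) ?_
  have h2 : (a - 6) * (a * a) + 6 * (a * a) = 21 * (a * a * u) := by
    rw [← Nat.add_mul, Nat.sub_add_cancel (by omega)]
    nth_rewrite 1 [ha]
    ring
  have h3 : 2 * (a * a) - a * a = a * a := by omega
  rw [h3, hd]
  omega

/-- In a locally sparse graph `G`, the sets above the threshold have low density. -/
theorem mul_arcCount_le {u a g : ℕ} (hu : 1 ≤ u) (ha : a = 21 * u)
    (hd : d + 1 = a * a * u) (hg : (d + 1).factorial ≤ g) (hgk : g ^ 10 ≤ k)
    (hkg : k < (g + 1) ^ 10)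
    (hG : ∀ S : Finset (Fin n), S.card ≤ k → #{p ∈ S ×ˢ S | G.Adj p.1 p.2} ≤ 4 * g * S.card)
    (S : Finset ℕ) (hS : threshold d k (g ^ 7) ≤ S.card) :
    u * arcCount d n k (g ^ 7) (natAdj G) S ≤ (d + 1) * g ^ 7 * (u + 3) * S.card := by
  have ha21 : 21 ≤ a := by omega
  have hA : 441 ≤ a * a := Nat.mul_le_mul ha21 ha21
  have hAu : a * a ≤ a * a * u := Nat.le_mul_of_pos_right _ hu
  have hut : u ≤ d + 1 := by rw [hd]; exact Nat.le_mul_of_pos_left _ (by omega)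
  have htg : d + 1 ≤ g := (Nat.self_le_factorial _).trans hg
  have hg0 : 0 < g := by omega
  have hw1 : 0 < g ^ 7 := by positivity
  have harc := arcCount_le (d := d) (k := k) (w := g ^ 7) G S
  set K := threshold d k (g ^ 7) with hK
  set Y := cliquesIn G S d with hY
  have hYS : Y.card ≤ S.card := card_cliquesIn_le G S
  have hFS : ∑ i ∈ range (g ^ 7), (facetsIn S d n i).card ≤ S.card := sum_card_facetsIn_le S
  -- Below tK the set is too small to contain many facets of many cliques. From tK on, the bipartite
  -- edges are negligible and the trivial bound of t facets per clique and copy is enough.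
  rcases Nat.lt_or_ge S.card ((d + 1) * K) with hlt | hge
  · have hheavy := card_heavy_lt (k := k) G (g := g) (by omega) (by
      refine le_trans ?_ hgk
      calc 2 * g ^ 3 ≤ g * g ^ 3 := by gcongr; omega
        _ = g ^ 4 := by ring
        _ ≤ g ^ 10 := Nat.pow_le_pow_right hg0 (by norm_num)) hG
    have hwk : g ^ 7 ≤ k := (Nat.pow_le_pow_right hg0 (by norm_num)).trans hgk
    have hF : ∀ i ∈ range (g ^ 7),
        (d + 1) * (facetsIn S d n i).card < facetThreshold g a (2 * (a * a)) := by
      intro i hi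
      refine lt_of_le_of_lt ?_ (facetThreshold_large (k := k) hu ha hd htg hkg)
      have h1 : (facetsIn S d n i).card ≤ (d + 1) * K :=
        ((single_le_sum (f := fun i => (facetsIn S d n i).card) (fun _ _ => Nat.zero_le _) hi).trans
          hFS).trans hlt.le
      calc _ ≤ (d + 1) * ((d + 1) * K) := Nat.mul_le_mul_left _ h1
        _ = (d + 1) ^ 3 * (k ^ d * g ^ 7) := by rw [hK, threshold]; ring
        _ ≤ (d + 1) ^ 3 * (k ^ d * k) := by gcongr
        _ = _ := by rw [pow_succ k d]
    have hsum : ∑ i ∈ range (g ^ 7), ∑ v ∈ Y,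
        #{p : Fin (d + 1) | p.removeNth (α := fun _ => Fin n) v ∈ facetsIn S d n i} ≤
        g ^ 7 * (2 * (a * a) * S.card) +
          (d + 1) ^ 2 * 2 ^ (d + 1) * (g ^ 6 + 1) * S.card := by
      have hi' : ∀ i ∈ range (g ^ 7), ∑ v ∈ Y, #{p : Fin (d + 1) |
          p.removeNth (α := fun _ => Fin n) v ∈ facetsIn S d n i} ≤ 2 * (a * a) * Y.card +
            (d + 1) ^ 2 * 2 ^ (d + 1) * (g ^ 6 + 1) * (facetsIn S d n i).card := by
        intro i hi
        have := sum_card_removeNth_le G hg0 (by omega) hheavy _ (hF i hi) Y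
          fun y hy => (mem_cliquesIn.1 hy).1
        convert this
      refine (sum_le_sum hi').trans ?_
      rw [sum_add_distrib, sum_const, card_range, smul_eq_mul, ← mul_sum]
      gcongr
    -- Exceptional cliques contribute at most one of the three extra units in u + 3; the other two
    -- come from 2a² = 2t/u facets per typical clique and copy.
    have hcost : u * ((d + 1) ^ 2 * 2 ^ (d + 1) * (g ^ 6 + 1)) ≤ (d + 1) * g ^ 7 := by
      have h1 := (Nat.sq_mul_two_pow_le_factorial (t := d + 1) (by omega)).trans hg
      calc u * ((d + 1) ^ 2 * 2 ^ (d + 1) * (g ^ 6 + 1))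
          ≤ (d + 1) * ((d + 1) ^ 2 * 2 ^ (d + 1) * (2 * g ^ 6)) := by
            gcongr
            have : 0 < g ^ 6 := by positivity
            omega
        _ = (d + 1) * ((d + 1) ^ 2 * 2 ^ (d + 1 + 1) * g ^ 6) := by ring
        _ ≤ (d + 1) * (g * g ^ 6) := by gcongr
        _ = _ := by ring
    calc u * arcCount d n k (g ^ 7) (natAdj G) S
        ≤ u * ((d + 1) * g ^ 7 * S.card + (g ^ 7 * (2 * (a * a) * S.card) +
          (d + 1) ^ 2 * 2 ^ (d + 1) * (g ^ 6 + 1) * S.card)) := by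
          refine Nat.mul_le_mul_left _ (harc.trans (add_le_add ?_ hsum))
          exact Nat.mul_le_mul_left _ hS
      _ = (d + 1) * g ^ 7 * u * S.card + g ^ 7 * (2 * (a * a * u)) * S.card +
          u * ((d + 1) ^ 2 * 2 ^ (d + 1) * (g ^ 6 + 1)) * S.card := by ring
      _ ≤ (d + 1) * g ^ 7 * u * S.card + g ^ 7 * (2 * (d + 1)) * S.card +
          (d + 1) * g ^ 7 * S.card := by rw [← hd]; gcongr
      _ = _ := by ring
  · have hsum : ∑ i ∈ range (g ^ 7), ∑ v ∈ Y,
        #{p : Fin (d + 1) | p.removeNth (α := fun _ => Fin n) v ∈ facetsIn S d n i} ≤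
        g ^ 7 * (S.card * (d + 1)) := by
      refine (sum_le_card_nsmul _ _ (S.card * (d + 1)) fun i _ => ?_).trans (by simp)
      refine (sum_le_card_nsmul _ _ (d + 1) fun v _ => (card_le_univ _).trans (by simp)).trans ?_
      rw [smul_eq_mul]
      gcongr
    have huK : u * K ≤ S.card := (Nat.mul_le_mul_right _ hut).trans hge
    calc u * arcCount d n k (g ^ 7) (natAdj G) S
        ≤ u * ((d + 1) * g ^ 7 * K + g ^ 7 * (S.card * (d + 1))) :=
          Nat.mul_le_mul_left _ (harc.trans (by gcongr))
      _ = (d + 1) * g ^ 7 * (u * K) + (d + 1) * g ^ 7 * u * S.card := by ring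
      _ ≤ (d + 1) * g ^ 7 * S.card + (d + 1) * g ^ 7 * u * S.card := by gcongr
      _ ≤ (d + 1) * g ^ 7 * (u + 3) * S.card := by
          have : (d + 1) * g ^ 7 * (u + 3) * S.card = (d + 1) * g ^ 7 * S.card +
            (d + 1) * g ^ 7 * u * S.card + 2 * ((d + 1) * g ^ 7 * S.card) := by ring
          omega

/-- A small set with many cliques gives a set near the threshold of high density. -/
theorem exists_dense_set {w : ℕ} (S₀ : Finset (Fin n)) (hS₀ : S₀.card = k)
    (hdk : (d + 1) ^ 2 ≤ k ^ d)
    (hK : threshold d k w ≤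
      #{v : Fin (d + 1) → Fin n | (∀ p q, p ≠ q → G.Adj (v p) (v q)) ∧ ∀ p, v p ∈ S₀}) :
    ∃ S ⊆ range (order d n k w), threshold d k w ≤ S.card ∧
      (d + 1) * S.card ≤ (d + 1 + 3) * threshold d k w ∧
      2 * ((d + 1) * w * threshold d k w) ≤ arcCount d n k w (natAdj G) S := by
  obtain ⟨Y, hY, hYc⟩ := exists_subset_card_eq hK
  have hYm : ∀ v ∈ Y, (∀ p q, p ≠ q → G.Adj (v p) (v q)) ∧ ∀ p, v p ∈ S₀ := fun v hv => by
    simpa using hY hv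
  set FS : Finset (ℕ × (Fin d → Fin n)) := range w ×ˢ Fintype.piFinset fun _ => S₀ with hFS
  have hFSc : FS.card = k ^ d * w := by
    rw [hFS, card_product, card_range, Fintype.card_piFinset_const, hS₀, mul_comm]
  set B : Finset ℕ := Ico (facetEnd d n w) (order d n k w) with hB
  have hBc : B.card = k ^ d * w + (d + 1) ^ 2 * w := by
    rw [hB, Nat.card_Ico, order, leftEnd]; omega
  set S := Y.image tupleIndex ∪ FS.image (fun x => facetIndex x.1 x.2) ∪ B with hSdef
  have hYimg : (Y.image tupleIndex).card = threshold d k w := by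
    rw [card_image_of_injective _ tupleIndex_injective, hYc]
  have hord : leftEnd d n k w ≤ order d n k w := Nat.le_add_right _ _
  have hleft : facetEnd d n w ≤ leftEnd d n k w := Nat.le_add_right _ _
  have hend : n ^ (d + 1) ≤ facetEnd d n w := Nat.le_add_right _ _
  refine ⟨S, ?_, ?_, ?_, ?_⟩
  · intro x hx
    rw [mem_range]
    rcases mem_union.1 hx with hx | hx
    · rcases mem_union.1 hx with hx | hx
      · obtain ⟨v, -, rfl⟩ := mem_image.1 hx
        exact (tupleIndex_lt v).trans_le (hend.trans (hleft.trans hord))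
      · obtain ⟨⟨i, f⟩, hif, rfl⟩ := mem_image.1 hx
        have hi : i < w := by simpa using (mem_product.1 hif).1
        exact (facetIndex_lt hi f).trans_le (hleft.trans hord)
    · exact (mem_Ico.1 hx).2
  · rw [← hYimg]
    exact card_le_card (subset_union_left.trans subset_union_left)
  · have h1 : S.card ≤ threshold d k w + k ^ d * w + (k ^ d * w + (d + 1) ^ 2 * w) := by
      refine (card_union_le _ _).trans (add_le_add ((card_union_le _ _).trans (add_le_add ?_ ?_)) ?_)
      · exact hYimg.le
      · exact card_image_le.trans hFSc.le
      · exact hBc.le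
    calc (d + 1) * S.card
        ≤ (d + 1) * (threshold d k w + k ^ d * w + (k ^ d * w + (d + 1) ^ 2 * w)) :=
          Nat.mul_le_mul_left _ h1
      _ ≤ (d + 1) * (threshold d k w + k ^ d * w + (k ^ d * w + k ^ d * w)) := by gcongr
      _ = _ := by rw [threshold]; ring
  · set A₁ : Finset (ℕ × ℕ) :=
      Ico (facetEnd d n w) (leftEnd d n k w) ×ˢ Ico (leftEnd d n k w) (order d n k w) with hA₁
    set A₂ : Finset (ℕ × ℕ) := (Y ×ˢ (univ : Finset (Fin (d + 1))) ×ˢ range w).image fun x =>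
      (tupleIndex x.1, facetIndex x.2.2 (x.2.1.removeNth (α := fun _ => Fin n) x.1)) with hA₂
    have hA₁c : A₁.card = (d + 1) * w * threshold d k w := by
      rw [hA₁, card_product, Nat.card_Ico, Nat.card_Ico, leftEnd, order, leftEnd,
        Nat.add_sub_cancel_left, Nat.add_sub_cancel_left, threshold]
      ring
    have hA₂c : A₂.card = (d + 1) * w * threshold d k w := by
      rw [hA₂, card_image_of_injOn, card_product, card_product, hYc, card_range, card_univ,
        Fintype.card_fin]
      · ring
      · rintro ⟨v, p, i⟩ hx ⟨v', p', i'⟩ hx' h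
        simp only [Prod.mk.injEq] at h
        obtain rfl := tupleIndex_injective h.1
        obtain ⟨rfl, h2⟩ := facetIndex_inj h.2
        have hv := (hYm v (mem_product.1 hx).1).1
        -- Equal facets at different positions would force two entries of the clique to coincide,
        -- although they are adjacent.
        have : p = p' := by
          by_contra hpp
          obtain ⟨q, hq⟩ := Fin.exists_succAbove_eq (Ne.symm hpp)
          have h3 : v p' = v (p'.succAbove q) := by
            have := congrFun h2 q
            simp only [Fin.removeNth, hq] at this
            exact this
          exact (hv _ _ (Fin.succAbove_ne p' q).symm).ne h3
        rw [this]
    have hdisj : Disjoint A₁ A₂ := by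
      refine disjoint_left.2 fun x hx hx' => ?_
      obtain ⟨⟨v, p, i⟩, -, rfl⟩ := mem_image.1 hx'
      have h1 := (mem_Ico.1 (mem_product.1 hx).1).1
      have h2 := tupleIndex_lt v
      simp only at h1
      omega
    have hsub : A₁ ∪ A₂ ⊆ {p ∈ S ×ˢ S | Arc d n k w (natAdj G) p.1 p.2} := by
      intro x hx
      rcases mem_union.1 hx with hx | hx
      · obtain ⟨h1, h2⟩ := mem_product.1 hx
        rw [mem_Ico] at h1 h2
        refine mem_filter.2 ⟨mem_product.2 ⟨?_, ?_⟩, .inr ⟨h1, h2⟩⟩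
        · exact mem_union_right _ (mem_Ico.2 ⟨h1.1, h1.2.trans_le hord⟩)
        · exact mem_union_right _ (mem_Ico.2 ⟨hleft.trans h2.1, h2.2⟩)
      · obtain ⟨⟨v, p, i⟩, hm, rfl⟩ := mem_image.1 hx
        have hv := (mem_product.1 hm).1
        have hi : i < w := by simpa using (mem_product.1 (mem_product.1 hm).2).2
        refine mem_filter.2 ⟨mem_product.2 ⟨?_, ?_⟩,
          .inl ((incident_iff G).2 ⟨v, i, p, (hYm v hv).1, hi, rfl, rfl⟩)⟩
        · exact mem_union_left _ (mem_union_left _ (mem_image_of_mem _ hv))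
        · refine mem_union_left _ (mem_union_right _ (mem_image.2
            ⟨(i, p.removeNth (α := fun _ => Fin n) v), mem_product.2 ⟨mem_range.2 hi, ?_⟩, rfl⟩))
          exact Fintype.mem_piFinset.2 fun q => (hYm v hv).2 _
    refine le_trans ?_ (card_le_card hsub)
    rw [card_union_of_disjoint hdisj, hA₁c, hA₂c]
    omega

end CliqueFacetGraph

/-! ### The completeness case -/

/-- Each clique is listed in increasing order. The other t! - 1 orderings are not needed. -/
theorem cliqueCount_le_card_tuples {n t : ℕ} (G : SimpleGraph (Fin n)) (S : Finset (Fin n)) :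
    cliqueCount G S t ≤
      #{v : Fin t → Fin n | (∀ p q, p ≠ q → G.Adj (v p) (v q)) ∧ ∀ p, v p ∈ S} := by
  rw [cliqueCount, ← Set.ncard_coe_finset]
  have hex : ∀ s ∈ (G.induce (S : Set (Fin n))).cliqueSet t, ∃ v : Fin t → Fin n,
      ((∀ p q, p ≠ q → G.Adj (v p) (v q)) ∧ ∀ p, v p ∈ S) ∧
        ∀ x, x ∈ s.map (Function.Embedding.subtype _) ↔ ∃ p, v p = x := by
    intro s hs
    have hs' := SimpleGraph.mem_cliqueSet_iff.1 hs
    set e := s.orderEmbOfFin hs'.card_eq with he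
    refine ⟨fun p => (e p : Fin n), ⟨fun p q hpq => ?_, fun p => (e p).2⟩, fun x => ?_⟩
    · exact hs'.isClique (orderEmbOfFin_mem s _ p) (orderEmbOfFin_mem s _ q)
        (e.injective.ne hpq)
    · have hrange : ∀ y, y ∈ s ↔ ∃ p, e p = y := fun y => by
        have := range_orderEmbOfFin s hs'.card_eq
        rw [← mem_coe, ← this]
        rfl
      simp only [mem_map, hrange]
      constructor
      · rintro ⟨_, ⟨p, rfl⟩, rfl⟩
        exact ⟨p, rfl⟩
      · rintro ⟨p, rfl⟩
        exact ⟨_, ⟨p, rfl⟩, rfl⟩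
  rcases ((G.induce (S : Set (Fin n))).cliqueSet t).eq_empty_or_nonempty with h0 | ⟨s₀, hs₀⟩
  · rw [h0, Set.ncard_empty]
    exact Nat.zero_le _
  have : Nonempty (Fin t → Fin n) := ⟨(hex s₀ hs₀).choose⟩
  choose! f hf hf' using hex
  refine Set.ncard_le_ncard_of_injOn f (fun s hs => by simpa using hf s hs) ?_ (Set.toFinite _)
  intro s hs s' hs' h
  refine map_injective (Function.Embedding.subtype _) (Finset.ext fun x => ?_)
  rw [hf' s hs, hf' s' hs', h]

theorem factorial_mul_cliqueCount_le {n t : ℕ} (G : SimpleGraph (Fin n)) (S : Finset (Fin n)) :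
    t.factorial * cliqueCount G S t ≤ S.card ^ t := by
  have h1 : cliqueCount G S t ≤ S.card.choose t := by
    rw [cliqueCount]
    have hsub : (G.induce (S : Set (Fin n))).cliqueSet t ⊆
        (powersetCard t (univ : Finset (S : Set (Fin n))) : Finset (Finset (S : Set (Fin n)))) :=
      fun s hs => mem_coe.2 (mem_powersetCard.2
        ⟨subset_univ _, (SimpleGraph.mem_cliqueSet_iff.1 hs).card_eq⟩)
    refine (Set.ncard_le_ncard hsub (Set.toFinite _)).trans_eq ?_
    rw [Set.ncard_coe_finset, card_powersetCard, card_univ]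
    simp
  calc _ ≤ t.factorial * S.card.choose t := Nat.mul_le_mul_left _ h1
    _ = S.card.descFactorial t := (Nat.descFactorial_eq_factorial_mul_choose _ _).symm
    _ ≤ _ := Nat.descFactorial_le_pow _ _

/-- The completeness case is possible for large `k` only. -/
theorem PolyGapDkS.Completeness.factorial_pow_le {n k t m : ℕ} {G : SimpleGraph (Fin n)}
    (hk : 1 ≤ k) (hm : m ≠ 0) (h : PolyGapDkS.Completeness (1 / m : ℝ) t G k) :
    t.factorial ^ m ≤ k := by
  obtain ⟨S, hS, h⟩ := h
  have hk0 : (0 : ℝ) < k := by exact_mod_cast hk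
  have h1 : (t.factorial : ℝ) * cliqueCount G S t ≤ (k : ℝ) ^ t := by
    rw [← hS]; exact_mod_cast factorial_mul_cliqueCount_le G S
  have h2 : (t.factorial : ℝ) * (k : ℝ) ^ ((t : ℝ) - 1 / m) ≤ (k : ℝ) ^ t :=
    (mul_le_mul_of_nonneg_left h (by positivity)).trans h1
  rw [Real.rpow_sub hk0, Real.rpow_natCast, ← mul_div_assoc,
    div_le_iff₀ (Real.rpow_pos_of_pos hk0 _), mul_comm] at h2
  -- There are at most k^t / t! cliques, so k^(t - 1/m) of them leave no room unless t! ≤ k^(1/m).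
  have h3 : (t.factorial : ℝ) ≤ (k : ℝ) ^ (1 / m : ℝ) :=
    le_of_mul_le_mul_left h2 (by positivity)
  have h4 : (t.factorial : ℝ) ^ m ≤ k := by
    calc (t.factorial : ℝ) ^ m ≤ ((k : ℝ) ^ (1 / m : ℝ)) ^ m :=
          pow_le_pow_left₀ (by positivity) h3 m
      _ = k := by
        rw [one_div, Real.rpow_inv_natCast_pow hk0.le hm]
  exact_mod_cast h4

/-- The number of cliques in the completeness case. -/
theorem PolyGapDkS.Completeness.exists_many_cliques {n k d g : ℕ} {G : SimpleGraph (Fin n)}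
    (hk : 1 ≤ k) (hg : d + 1 ≤ g) (hgk : g ^ 10 ≤ k)
    (h : PolyGapDkS.Completeness (1 / (10 : ℕ) : ℝ) (d + 1) G k) :
    ∃ S : Finset (Fin n), S.card = k ∧ CliqueFacetGraph.threshold d k (g ^ 7) ≤
      #{v : Fin (d + 1) → Fin n | (∀ p q, p ≠ q → G.Adj (v p) (v q)) ∧ ∀ p, v p ∈ S} := by
  obtain ⟨S, hS, h⟩ := h
  refine ⟨S, hS, le_trans ?_ (cliqueCount_le_card_tuples G S)⟩
  have hk0 : (0 : ℝ) < k := by exact_mod_cast hk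
  have hg1 : (1 : ℝ) ≤ g := by exact_mod_cast (show 1 ≤ g by omega)
  -- The threshold t k^d g^7 is at most k^d g^9, hence at most k^(t - 1/10).
  have h9 : (g : ℝ) ^ 9 ≤ (k : ℝ) ^ (9 / 10 : ℝ) := by
    calc (g : ℝ) ^ 9 = ((g : ℝ) ^ (10 : ℕ)) ^ (9 / 10 : ℝ) := by
          rw [← Real.rpow_natCast, ← Real.rpow_natCast, ← Real.rpow_mul (by positivity)]
          norm_num
      _ ≤ _ := Real.rpow_le_rpow (by positivity) (by exact_mod_cast hgk) (by norm_num)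
  have hd : ((d + 1 : ℕ) : ℝ) ≤ g := by exact_mod_cast hg
  have h1 : ((CliqueFacetGraph.threshold d k (g ^ 7) : ℕ) : ℝ) ≤
      (k : ℝ) ^ (((d + 1 : ℕ) : ℝ) - 1 / (10 : ℕ)) := by
    have he : ((d + 1 : ℕ) : ℝ) - 1 / (10 : ℕ) = (d : ℝ) + 9 / 10 := by push_cast; ring
    rw [he, Real.rpow_add hk0, Real.rpow_natCast, CliqueFacetGraph.threshold]
    push_cast at hd ⊢
    calc ((d : ℝ) + 1) * ((k : ℝ) ^ d * (g : ℝ) ^ 7)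
        ≤ (g * g) * ((k : ℝ) ^ d * (g : ℝ) ^ 7) := by
          gcongr
          nlinarith
      _ = (k : ℝ) ^ d * (g : ℝ) ^ 9 := by ring
      _ ≤ _ := by gcongr
  exact_mod_cast h1.trans h

namespace CliqueFacetGraph

open RAM

/-! ### The reduction on the random access machine -/

theorem digit_lt {n : ℕ} (hn : 0 < n) (x i : ℕ) : digit n x i < n := Nat.mod_lt _ hn

/-- Digits are always below n, so only the n² matrix entries matter; later writes beyond them are
harmless. -/
theorem Arc.congr {d n k w : ℕ} {adj adj' : ℕ → ℕ → Prop} (hn : 0 < n)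
    (h : ∀ i < n, ∀ j < n, adj i j ↔ adj' i j) (x y : ℕ) :
    Arc d n k w adj x y ↔ Arc d n k w adj' x y := by
  unfold Arc Incident
  refine or_congr (and_congr_right fun _ => and_congr (forall₃_congr fun p q _ =>
    h _ (digit_lt hn _ _) _ (digit_lt hn _ _)) Iff.rfl) Iff.rfl

/-- The graph as a simple graph. -/
def graph (d n k w : ℕ) (adj : ℕ → ℕ → Prop) : SimpleGraph (Fin (order d n k w)) where
  Adj x y := Arc d n k w adj x y ∨ Arc d n k w adj y x
  symm := ⟨fun _ _ h => h.symm⟩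
  loopless := ⟨fun _ h => h.elim (fun h => h.lt.false) (fun h => h.lt.false)⟩

/-- The adjacency stored as a matrix in the memory. -/
def memAdj (n : ℕ) (m : ℕ → ℕ) (i j : ℕ) : Prop := m (i * n + j) ≠ 0

theorem cell_lt {n i j : ℕ} (hi : i < n) (hj : j < n) : i * n + j < n * n := by
  have : (i + 1) * n ≤ n * n := Nat.mul_le_mul_right _ hi
  rw [Nat.add_mul] at this
  omega

theorem memAdj_congr {n : ℕ} {m m' : ℕ → ℕ} (h : ∀ x < n * n, m x = m' x) {i j : ℕ} (hi : i < n)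
    (hj : j < n) : memAdj n m i j ↔ memAdj n m' i j := by
  unfold memAdj
  rw [h _ (cell_lt hi hj)]

theorem input_mem_ne_zero {n : ℕ} (G : SimpleGraph (Fin n)) (k : ℕ) {i j : ℕ} (hi : i < n)
    (hj : j < n) : (RAM.input G k).mem (i * n + j) ≠ 0 ↔ G.Adj ⟨i, hi⟩ ⟨j, hj⟩ := by
  simp only [RAM.input, ne_eq, ite_eq_right_iff, one_ne_zero, imp_false, not_not]
  constructor
  · rintro ⟨i', j', h, hadj⟩
    have hj' := j'.isLt
    have hn : 0 < n := by omega
    have h1 := congrArg (· / n) h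
    have h2 := congrArg (· % n) h
    simp only [mul_comm _ n, Nat.mul_add_div hn, Nat.div_eq_of_lt hj, Nat.div_eq_of_lt hj',
      Nat.mul_add_mod, Nat.mod_eq_of_lt hj, Nat.mod_eq_of_lt hj'] at h1 h2
    have e1 : (⟨i, hi⟩ : Fin n) = i' := Fin.ext (by simpa using h1)
    have e2 : (⟨j, hj⟩ : Fin n) = j' := Fin.ext h2
    rwa [e1, e2]
  · exact fun h => ⟨⟨i, hi⟩, ⟨j, hj⟩, rfl, h⟩

theorem input_mem_of_le {n : ℕ} (G : SimpleGraph (Fin n)) (k : ℕ) {x : ℕ} (hx : n * n ≤ x) :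
    (RAM.input G k).mem x = 0 := by
  simp only [RAM.input]
  refine if_neg ?_
  rintro ⟨i, j, rfl, -⟩
  exact absurd (cell_lt i.isLt j.isLt) (by omega)

theorem memAdj_input {n : ℕ} (G : SimpleGraph (Fin n)) (k : ℕ) {i j : ℕ} (hi : i < n)
    (hj : j < n) : memAdj n (RAM.input G k).mem i j ↔ natAdj G i j := by
  rw [memAdj, input_mem_ne_zero G k hi hj]
  simp [natAdj, hi, hj]

section Computability

variable {α : Type} [Ctx α] {fn fk fw fx fy : α → (ℕ → ℕ) → ℕ}

theorem polyComputable_digit (hn : PolyComputable fn) (hx : PolyComputable fx) (i : ℕ) :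
    PolyComputable (fun a m => digit (fn a m) (fx a m) i) :=
  (hx.div (hn.pow i)).mod hn

theorem polyComputable_facetEnd (d : ℕ) (hn : PolyComputable fn) (hw : PolyComputable fw) :
    PolyComputable (fun a m => facetEnd d (fn a m) (fw a m)) :=
  (hn.pow (d + 1)).add ((hn.pow d).mul hw)

theorem polyComputable_leftEnd (d : ℕ) (hn : PolyComputable fn) (hk : PolyComputable fk)
    (hw : PolyComputable fw) : PolyComputable (fun a m => leftEnd d (fn a m) (fk a m) (fw a m)) :=
  (polyComputable_facetEnd d hn hw).add ((hk.pow d).mul hw)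

theorem polyComputable_order (d : ℕ) (hn : PolyComputable fn) (hk : PolyComputable fk)
    (hw : PolyComputable fw) : PolyComputable (fun a m => order d (fn a m) (fk a m) (fw a m)) :=
  (polyComputable_leftEnd d hn hk hw).add ((PolyComputable.const ((d + 1) ^ 2)).mul hw)

theorem polyComputable_threshold (d : ℕ) (hk : PolyComputable fk) (hw : PolyComputable fw) :
    PolyComputable (fun a m => threshold d (fk a m) (fw a m)) :=
  (PolyComputable.const (d + 1)).mul ((hk.pow d).mul hw)

/-- As d is fixed, the quantifiers over positions unroll into a fixed number of tests. -/
theorem polyDecidable_arc (d : ℕ) (hn : PolyComputable fn) (hk : PolyComputable fk)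
    (hw : PolyComputable fw) (hx : PolyComputable fx) (hy : PolyComputable fy) :
    PolyDecidable (fun a m =>
      Arc d (fn a m) (fk a m) (fw a m) (memAdj (fn a m) m) (fx a m) (fy a m)) := by
  have hF := polyComputable_facetEnd d hn hw
  have hL := polyComputable_leftEnd d hn hk hw
  have hN := polyComputable_order d hn hk hw
  have hT := hn.pow (d + 1)
  refine PolyDecidable.or (PolyDecidable.and (PolyDecidable.and (.lt hx hT)
    (PolyDecidable.and (.le hT hy) (.lt hy hF))) (PolyDecidable.and ?_ ?_))
    (PolyDecidable.and (PolyDecidable.and (.le hF hx) (.lt hx hL))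
      (PolyDecidable.and (.le hL hy) (.lt hy hN)))
  · refine PolyDecidable.forall_fin fun p => PolyDecidable.forall_fin fun q => ?_
    by_cases hpq : p = q
    · exact PolyDecidable.true.congr fun a m => by simp [hpq]
    · exact (PolyDecidable.mem (((polyComputable_digit hn hx p).mul hn).add
        (polyComputable_digit hn hx q))).congr fun a m => by simp [hpq, memAdj]
  · exact PolyDecidable.exists_fin fun p => PolyDecidable.forall_fin fun i =>
      .eq (polyComputable_digit hn (hy.sub hT) i) (polyComputable_digit hn hx _)

/-- The set stored in the memory from cell `D` on. -/
noncomputable def storedSet (m : ℕ → ℕ) (D N : ℕ) : Finset ℕ := {x ∈ range N | m (D + x) ≠ 0}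

theorem polyComputable_card_storedSet {fD fN : α → (ℕ → ℕ) → ℕ} (hD : PolyComputable fD)
    (hN : PolyComputable fN) :
    PolyComputable (fun a m => (storedSet m (fD a m) (fN a m)).card) :=
  (hN.sum (g := fun a m => if m (fD a.1 m + a.2) ≠ 0 then 1 else 0)
    (hD.weaken.add .var).memNeZero).congr fun a m => by rw [storedSet, card_filter]

theorem polyComputable_arcCount_storedSet (d : ℕ) {fD fN : α → (ℕ → ℕ) → ℕ}
    (hn : PolyComputable fn) (hk : PolyComputable fk) (hw : PolyComputable fw)
    (hD : PolyComputable fD) (hN : PolyComputable fN) :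
    PolyComputable (fun a m => arcCount d (fn a m) (fk a m) (fw a m) (memAdj (fn a m) m)
      (storedSet m (fD a m) (fN a m))) := by
  have hx : PolyComputable (fun (a : (α × ℕ) × ℕ) (_ : ℕ → ℕ) => a.1.2) :=
    PolyComputable.var.weaken
  have h := hN.sum (hN.weaken.sum (((PolyDecidable.mem (hD.weaken.weaken.add hx)).and
    ((PolyDecidable.mem (hD.weaken.weaken.add .var)).and (polyDecidable_arc d hn.weaken.weaken
      hk.weaken.weaken hw.weaken.weaken hx .var))).ite (.const 1) (.const 0)))
  refine h.congr fun a m => ?_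
  rw [arcCount, storedSet, card_filter, sum_product, sum_filter]
  refine sum_congr rfl fun x _ => ?_
  dsimp only
  rw [sum_filter]
  by_cases h1 : m (fD a m + x) ≠ 0
  · rw [if_pos h1]
    refine sum_congr rfl fun y _ => ?_
    by_cases h2 : m (fD a m + y) ≠ 0 <;> simp [h1, h2]
  · rw [if_neg h1]
    refine (sum_eq_zero fun y _ => if_neg fun h => h1 h.1).symm

end Computability

end CliqueFacetGraph

/-! ### The program of the reduction -/

namespace CliqueFacetGraph

open RAM

/-- The number of copies of each facet: the seventh power of the tenth root of `k`. -/
def copies (k : ℕ) : ℕ := Nat.nthRoot 10 k ^ 7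

/-- The numbers of vertices and the parameter, as a tuple. -/
abbrev Params : Type := (Unit × ℕ) × ℕ

theorem polyComputable_n : PolyComputable (fun (a : Params) _ => a.1.2) :=
  PolyComputable.var.weaken

theorem polyComputable_k : PolyComputable (fun (a : Params) _ => a.2) := PolyComputable.var

theorem polyComputable_copies : PolyComputable (fun (a : Params) _ => copies a.2) :=
  (polyComputable_k.nthRoot (by norm_num)).pow 7

theorem polyComputable_order_params (d : ℕ) :
    PolyComputable (fun (a : Params) _ => order d a.1.2 a.2 (copies a.2)) :=
  polyComputable_order d polyComputable_n polyComputable_k polyComputable_copies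

theorem polyComputable_threshold_params (d : ℕ) :
    PolyComputable (fun (a : Params) _ => threshold d a.2 (copies a.2)) :=
  polyComputable_threshold d polyComputable_k polyComputable_copies

theorem params_bounded {n k : ℕ} (h : k ≤ n) : Ctx.Bounded (α := Params) (((), n), k) n := by
  have h0 : Ctx.Bounded (α := Unit) () n := fun i hi => absurd hi (Nat.not_lt_zero i)
  exact (h0.extend le_rfl).extend h

theorem params_holds {n k : ℕ} {s : State} (h0 : s.reg 0 = n) (h1 : s.reg 1 = k) :
    Ctx.Holds (α := Params) id s (((), n), k) := by
  intro i hi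
  change i < 2 at hi
  interval_cases i
  · exact h0
  · exact h1

theorem id_lt_of_two_le {b : ℕ} (hb : 2 ≤ b) : ∀ i < Ctx.dim Params, id i < b :=
  fun _ hi => lt_of_lt_of_le hi hb

/-- The entry of the adjacency matrix of the reduced graph. -/
theorem polyComputable_entry (d : ℕ) : PolyComputable (fun (a : Params × ℕ) m =>
    if Arc d a.1.1.2 a.1.2 (copies a.1.2) (memAdj a.1.1.2 m)
          (a.2 / order d a.1.1.2 a.1.2 (copies a.1.2)) (a.2 % order d a.1.1.2 a.1.2 (copies a.1.2)) ∨
        Arc d a.1.1.2 a.1.2 (copies a.1.2) (memAdj a.1.1.2 m)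
          (a.2 % order d a.1.1.2 a.1.2 (copies a.1.2)) (a.2 / order d a.1.1.2 a.1.2 (copies a.1.2))
      then 1 else 0) := by
  have hN := (polyComputable_order_params d).weaken
  have hx := PolyComputable.div PolyComputable.var hN
  have hy := PolyComputable.mod PolyComputable.var hN
  exact ((polyDecidable_arc d polyComputable_n.weaken polyComputable_k.weaken
    polyComputable_copies.weaken hx hy).or (polyDecidable_arc d polyComputable_n.weaken
    polyComputable_k.weaken polyComputable_copies.weaken hy hx)).ite (.const 1) (.const 0)

theorem polyComputable_accept (d u : ℕ) : PolyComputable (fun (a : Params) m =>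
    if (d + 1) * copies a.2 * (u + 3) *
        (storedSet m (a.1.2 * a.1.2) (order d a.1.2 a.2 (copies a.2))).card <
      u * arcCount d a.1.2 a.2 (copies a.2) (memAdj a.1.2 m)
        (storedSet m (a.1.2 * a.1.2) (order d a.1.2 a.2 (copies a.2))) then 1 else 0) := by
  have hD := polyComputable_n.mul polyComputable_n
  have hN := polyComputable_order_params d
  exact (PolyDecidable.lt ((((PolyComputable.const (d + 1)).mul polyComputable_copies).mul
    (.const (u + 3))).mul (polyComputable_card_storedSet hD hN))
    ((PolyComputable.const u).mul (polyComputable_arcCount_storedSet d polyComputable_n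
      polyComputable_k polyComputable_copies hD hN))).ite (.const 1) (.const 0)

theorem input_graph_mem {d n k w : ℕ} (G : SimpleGraph (Fin n)) (K x : ℕ) :
    (RAM.input (graph d n k w (natAdj G)) K).mem x =
      if x < order d n k w * order d n k w then
        if Arc d n k w (natAdj G) (x / order d n k w) (x % order d n k w) ∨
          Arc d n k w (natAdj G) (x % order d n k w) (x / order d n k w) then 1 else 0
      else 0 := by
  split_ifs with hx h
  · have hN : 0 < order d n k w := Nat.pos_of_ne_zero fun h => by simp [h] at hx
    have h1 := (input_mem_ne_zero (graph d n k w (natAdj G)) K (Nat.div_lt_of_lt_mul hx)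
      (Nat.mod_lt x hN)).2 h
    rw [Nat.div_add_mod'] at h1
    simp only [RAM.input] at h1 ⊢
    by_contra h2
    split_ifs at h1 h2 <;> simp_all
  · have hN : 0 < order d n k w := Nat.pos_of_ne_zero fun h => by simp [h] at hx
    have h1 := (input_mem_ne_zero (graph d n k w (natAdj G)) K (Nat.div_lt_of_lt_mul hx)
      (Nat.mod_lt x hN)).not.2 h
    rw [Nat.div_add_mod'] at h1
    simpa using h1
  · exact input_mem_of_le _ _ (not_lt.1 hx)

/-- The reduction as a program: it calls the program `p` on the reduced graph and compares the
density of the set that `p` returns with a threshold. -/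
theorem exists_reduction_program (d u c : ℕ) (p : Program) : ∃ (P : Program) (e : ℕ),
    ∀ (n : ℕ) (G : SimpleGraph (Fin n)) (k : ℕ), 1 ≤ k →
      (¬ (k ≤ n ∧ c ≤ k) →
        ∃ s T, Exec P (RAM.input G k) s T ∧ T ≤ (n + 2) ^ e ∧ ¬ s.Accepts) ∧
      (k ≤ n → c ≤ k → ∀ s₀ T₀, Exec p (RAM.input (graph d n k (copies k) (natAdj G))
          (threshold d k (copies k))) s₀ T₀ →
        ∃ s T, Exec P (RAM.input G k) s T ∧ T ≤ (n + 2) ^ e + 2 * T₀ ∧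
          (s.Accepts ↔ (d + 1) * copies k * (u + 3) *
              (storedSet s₀.mem 0 (order d n k (copies k))).card <
            u * arcCount d n k (copies k) (natAdj G)
              (storedSet s₀.mem 0 (order d n k (copies k))))) := by
  obtain ⟨e₁, -, h₁⟩ := polyComputable_n.mul polyComputable_n
  obtain ⟨P₁, R₁, hR₁, h₁⟩ := h₁ id 2 (id_lt_of_two_le le_rfl)
  obtain ⟨e₂, h₂⟩ := ((polyComputable_order_params d).mul
    (polyComputable_order_params d)).exists_table (polyComputable_entry d)
  obtain ⟨P₂, R₂, hR₂, h₂⟩ := h₂ id 3 2 (id_lt_of_two_le (by norm_num)) (by norm_num)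
  obtain ⟨e₃, -, h₃⟩ := polyComputable_order_params d
  obtain ⟨P₃, R₃, hR₃, h₃⟩ := h₃ id 3 (id_lt_of_two_le (by norm_num))
  obtain ⟨e₄, -, h₄⟩ := polyComputable_threshold_params d
  obtain ⟨P₄, R₄, hR₄, h₄⟩ := h₄ id 4 (id_lt_of_two_le (by norm_num))
  obtain ⟨e₅, -, h₅⟩ := polyComputable_accept d u
  obtain ⟨P₅, R₅, hR₅, h₅⟩ := h₅ id 3 (id_lt_of_two_le (by norm_num))
  set R := max R₁ (max R₂ (max R₃ R₄)) with hR
  -- Registers 0 and 1 keep n and k, 2 holds the offset n², 3 and 4 the new order and threshold.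
  -- Registers from R on belong to `p`; during its run register 3 serves for addresses, afterwards
  -- for the verdict.
  set main : Program := .seq (.seq (.seq (.seq (.seq (.seq (.seq (.seq P₁ P₂) P₃) P₄)
    (.move (0 + R) 3)) (.move (1 + R) 4)) (p.relocate R 2 3)) P₅) (.move 0 3) with hmain
  -- The guards test whether the truncated differences k - n and c - k vanish. Once k ≤ n, all
  -- bounds are powers of n + 2.
  refine ⟨.seq (.sub 2 1 0) (.cond 2 (.const 0 0) (.seq (.seq (.const 2 c) (.sub 2 2 1))
    (.cond 2 (.const 0 0) main))), e₁ + e₂ + 1 + e₃ + 1 + e₄ + 1 + e₅ + 1 + 8, fun n G k hk => ?_⟩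
  set E := e₁ + e₂ + 1 + e₃ + 1 + e₄ + 1 + e₅ + 1 + 8 with hE
  have hE8 : 8 ≤ (n + 2) ^ E :=
    calc 8 = 2 ^ 3 := by norm_num
      _ ≤ (n + 2) ^ 3 := Nat.pow_le_pow_left (by omega) _
      _ ≤ (n + 2) ^ E := Nat.pow_le_pow_right (by omega) (by omega)
  set s := RAM.input G k with hs
  have hs0 : s.reg 0 = n := rfl
  have hs1 : s.reg 1 = k := rfl
  have hsr : ∀ r, 2 ≤ r → s.reg r = 0 := fun r hr => by
    simp only [hs, RAM.input]
    rw [if_neg (by omega), if_neg (by omega)]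
  refine ⟨fun hcon => ?_, fun hkn hck s₀ T₀ hp => ?_⟩
  · by_cases hkn : k ≤ n
    · have hck : ¬ c ≤ k := fun h => hcon ⟨hkn, h⟩
      refine ⟨_, _, .seq (.sub _ _ _ _) (.cond_false ?_ (.seq (.seq (.const _ _ _) (.sub _ _ _ _))
        (.cond_true ?_ (.const _ _ _)))), ?_, ?_⟩
      · simp [State.setReg, hs0, hs1, hkn]
      · simp [State.setReg, hs1]
        omega
      · omega
      · simp [State.Accepts, State.setReg]
    · refine ⟨_, _, .seq (.sub _ _ _ _) (.cond_true ?_ (.const _ _ _)), ?_, ?_⟩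
      · simp [State.setReg, hs0, hs1]
        omega
      · omega
      · simp [State.Accepts, State.setReg]
  have hn : 0 < n := by omega
  have hb := params_bounded hkn
  set s' := ((s.setReg 2 (s.reg 1 - s.reg 0)).setReg 2 c).setReg 2
    (((s.setReg 2 (s.reg 1 - s.reg 0)).setReg 2 c).reg 2 -
      ((s.setReg 2 (s.reg 1 - s.reg 0)).setReg 2 c).reg 1) with hs'
  have hs'0 : s'.reg 0 = n := by simp [hs', State.setReg, hs0]
  have hs'1 : s'.reg 1 = k := by simp [hs', State.setReg, hs1]
  have hs'r : ∀ r, 2 ≤ r → s'.reg r = 0 := fun r hr => by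
    by_cases h2 : r = 2
    · subst h2
      simp [hs', State.setReg, hs1, hck]
    · simp [hs', State.setReg, h2, hsr r hr]
  have hs'm : s'.mem = s.mem := rfl
  -- the offset
  obtain ⟨s₁, T₁, E₁, t₁, m₁, k₁, v₁⟩ := h₁ s' _ n (params_holds hs'0 hs'1) hb
  have hs₁0 : s₁.reg 0 = n := by rw [k₁ 0 (by omega), hs'0]
  have hs₁1 : s₁.reg 1 = k := by rw [k₁ 1 (by omega), hs'1]
  have hcongr : ∀ m : ℕ → ℕ, (∀ x < n * n, m x = s.mem x) → ∀ x y,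
      Arc d n k (copies k) (memAdj n m) x y ↔ Arc d n k (copies k) (natAdj G) x y := fun m hm =>
    Arc.congr hn fun i hi j hj => (memAdj_congr hm hi hj).trans (memAdj_input G k hi hj)
  -- the adjacency matrix
  have hmem₁ : ∀ x < n * n, s₁.mem x = s.mem x := fun x _ => by rw [m₁, hs'm]
  obtain ⟨s₂, T₂, E₂, t₂, k₂, m₂, n₂⟩ := h₂ s₁ _ n (params_holds hs₁0 hs₁1) hb (by
    intro i m hm
    rw [v₁] at hm
    have hm' : ∀ x < n * n, m x = s.mem x := fun x hx => (hm x hx).trans (hmem₁ x hx)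
    simp only [hcongr m hm', hcongr _ hmem₁])
  rw [v₁] at m₂ n₂
  dsimp only at m₂ n₂
  have hs₂0 : s₂.reg 0 = n := by rw [k₂ 0 (by omega), hs₁0]
  have hs₂1 : s₂.reg 1 = k := by rw [k₂ 1 (by omega), hs₁1]
  have hs₂2 : s₂.reg 2 = n * n := by rw [k₂ 2 (by omega), v₁]
  -- the parameters
  obtain ⟨s₃, T₃, E₃, t₃, m₃, k₃, v₃⟩ := h₃ s₂ _ n (params_holds hs₂0 hs₂1) hb
  obtain ⟨s₄, T₄, E₄, t₄, m₄, k₄, v₄⟩ := h₄ s₃ _ n (params_holds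
    (by rw [k₃ 0 (by omega), hs₂0]) (by rw [k₃ 1 (by omega), hs₂1])) hb
  set s₅ := s₄.setReg (0 + R) (s₄.reg 3) with hs₅
  set s₆ := s₅.setReg (1 + R) (s₅.reg 4) with hs₆
  have hs₆lt : ∀ r < R, s₆.reg r = s₄.reg r := fun r hr => by
    simp only [hs₆, hs₅, State.setReg]
    rw [Function.update_of_ne (by omega), Function.update_of_ne (by omega)]
  -- The registers of `p` are still zero, as its initial state demands.
  have hs₄ge : ∀ r, R ≤ r → s₄.reg r = 0 := fun r hr => by
    rw [k₄ r (by omega), k₃ r (by omega), k₂ r (by omega), k₁ r (by omega), hs'r r (by omega)]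
  have hs₆m : s₆.mem = s₂.mem := by
    rw [← m₃, ← m₄]
    rfl
  have hrel : Relocates R 2 (n * n) (RAM.input (graph d n k (copies k) (natAdj G))
      (threshold d k (copies k))) s₆ := by
    refine ⟨fun r => ?_, fun x => ?_, ?_⟩
    · simp only [hs₆, hs₅, State.setReg, RAM.input]
      by_cases h0 : r = 0
      · subst h0
        rw [Function.update_of_ne (by omega), Function.update_self, k₄ 3 (by omega), v₃, if_pos rfl]
      · by_cases h1 : r = 1
        · subst h1
          rw [Function.update_self, Function.update_of_ne (by omega), v₄, if_neg (by omega),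
            if_pos rfl]
        · rw [Function.update_of_ne (by omega), Function.update_of_ne (by omega),
            hs₄ge _ (by omega), if_neg h0, if_neg h1]
    · rw [hs₆m, n₂, input_graph_mem]
      refine if_congr Iff.rfl ?_ ?_
      · simp only [hcongr _ hmem₁]
      · rw [m₁, hs'm]
        exact input_mem_of_le G k (by omega)
    · rw [hs₆lt 2 (by omega), k₄ 2 (by omega), k₃ 2 (by omega), hs₂2]
  obtain ⟨s₇, T₇, E₇, t₇, hrel', k₇, m₇⟩ :=
    hp.relocate (R := R) (d := 2) (w := 3) (by omega) (by omega) (by omega) s₆ hrel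
  have hs₇0 : s₇.reg 0 = n := by
    rw [k₇ 0 (by omega) (by omega), hs₆lt 0 (by omega), k₄ 0 (by omega), k₃ 0 (by omega), hs₂0]
  have hs₇1 : s₇.reg 1 = k := by
    rw [k₇ 1 (by omega) (by omega), hs₆lt 1 (by omega), k₄ 1 (by omega), k₃ 1 (by omega), hs₂1]
  have hs₇m : ∀ x < n * n, s₇.mem x = s.mem x := fun x hx => by
    rw [m₇ x hx, hs₆m, m₂ x hx, m₁, hs'm]
  obtain ⟨s₈, T₈, E₈, t₈, m₈, k₈, v₈⟩ := h₅ s₇ _ n (params_holds hs₇0 hs₇1) hb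
  have hstored : storedSet s₇.mem (n * n) (order d n k (copies k)) = storedSet s₀.mem 0 (order d n k (copies k)) := by
    unfold storedSet
    refine filter_congr fun x _ => ?_
    rw [hrel'.mem, zero_add]
  have harc : ∀ S, arcCount d n k (copies k) (memAdj n s₇.mem) S = arcCount d n k (copies k) (natAdj G) S := fun S => by
    unfold arcCount
    simp only [hcongr _ hs₇m]
  refine ⟨_, _, .seq (.sub _ _ _ _) (.cond_false ?_ (.seq (.seq (.const _ _ _) (.sub _ _ _ _))
    (.cond_false ?_ (.seq (.seq (.seq (.seq (.seq (.seq (.seq (.seq E₁ E₂) E₃) E₄)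
      (.move _ _ _)) (.move _ _ _)) E₇) E₈) (.move _ _ _))))), ?_, ?_⟩
  · simp [State.setReg, hs0, hs1, hkn]
  · exact hs'r 2 le_rfl
  · have h1 := add_two_le_pow (add_two_le_pow (add_two_le_pow (add_two_le_pow
      (add_le_pow_add_two (add_le_pow_add_two (add_le_pow_add_two
        (add_le_pow_add_two t₁ t₂) t₃) t₄) t₈))))
    have h2 : e₁ + e₂ + 1 + e₃ + 1 + e₄ + 1 + e₅ + 1 + 2 + 2 + 2 + 2 = E := by omega
    rw [h2] at h1
    omega
  · simp only [State.Accepts, State.setReg, Function.update_self, v₈]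
    rw [hstored, harc]
    simp

end CliqueFacetGraph

/-! ### Correctness of the reduction -/

namespace CliqueFacetGraph

open RAM

theorem arcCount_map {d n k w : ℕ} (adj : ℕ → ℕ → Prop) (S : Finset (Fin (order d n k w))) :
    arcCount d n k w adj (S.map Fin.valEmbedding) =
      #{p ∈ S ×ˢ S | Arc d n k w adj p.1 p.2} := by
  unfold arcCount
  rw [card_filter, card_filter, sum_product, sum_product, sum_map]
  exact sum_congr rfl fun x _ => sum_map _ _ _

theorem density_graph {d n k w : ℕ} (adj : ℕ → ℕ → Prop) (S : Finset (Fin (order d n k w))) :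
    density (graph d n k w adj) S = (arcCount d n k w adj (S.map Fin.valEmbedding) : ℝ) / S.card := by
  rw [arcCount_map]
  exact density_eq _ (fun x y => Arc d n k w adj x y) (fun x y => Iff.rfl) (fun x y h => h.lt) S

theorem storedSet_eq_map (s : State) (N : ℕ) :
    storedSet s.mem 0 N = (s.vertexSet N).map Fin.valEmbedding := by
  ext x
  simp only [storedSet, State.vertexSet, mem_filter, mem_range, mem_map, mem_univ, true_and,
    zero_add]
  constructor
  · rintro ⟨hx, h⟩
    exact ⟨⟨x, hx⟩, h, rfl⟩
  · rintro ⟨v, h, rfl⟩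
    exact ⟨v.isLt, h⟩

theorem exists_map_eq {N : ℕ} {S : Finset ℕ} (h : S ⊆ range N) :
    ∃ S' : Finset (Fin N), S'.map Fin.valEmbedding = S := by
  refine ⟨({x | (x : ℕ) ∈ S} : Finset (Fin N)), ?_⟩
  ext x
  simp only [mem_map, mem_filter, mem_univ, true_and]
  constructor
  · rintro ⟨v, hv, rfl⟩
    exact hv
  · exact fun hx => ⟨⟨x, mem_range.1 (h hx)⟩, hx, rfl⟩

theorem threshold_le_order {d n k g : ℕ} (hkn : k ≤ n) (hg : d + 1 ≤ g) (hgk : g ^ 10 ≤ k) :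
    threshold d k (g ^ 7) ≤ order d n k (g ^ 7) := by
  have hg0 : 0 < g := by omega
  calc threshold d k (g ^ 7) = k ^ d * ((d + 1) * g ^ 7) := by rw [threshold]; ring
    _ ≤ k ^ d * k := by
        gcongr
        refine le_trans ?_ hgk
        calc (d + 1) * g ^ 7 ≤ g * g ^ 7 := by gcongr
          _ = g ^ 8 := by ring
          _ ≤ g ^ 10 := Nat.pow_le_pow_right hg0 (by norm_num)
    _ ≤ n ^ (d + 1) := by rw [← pow_succ]; gcongr
    _ ≤ order d n k (g ^ 7) := by
        unfold order leftEnd facetEnd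
        omega

/-- The comparison with a set of high density. -/
theorem lt_of_density_le {ε : ℝ} {t u w K c c₁ A A₁ : ℕ} (hw : 0 < w) (hK : 0 < K)
    (hu : 12 ≤ ε * (u + 3)) (hut : u ≤ t) (ht : 0 < t) (hc : 0 < c) (hc₁ : 0 < c₁)
    (hA₁ : 2 * (t * w * K) ≤ A₁) (htc : t * c₁ ≤ (t + 3) * K)
    (h : (A₁ : ℝ) / c₁ ≤ (2 - ε) * ((A : ℝ) / c)) : t * w * (u + 3) * c < u * A := by
  have hc' : (0 : ℝ) < c := by exact_mod_cast hc
  have hc₁' : (0 : ℝ) < c₁ := by exact_mod_cast hc₁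
  have ht' : (0 : ℝ) < t := by exact_mod_cast ht
  have hw' : (0 : ℝ) < w := by exact_mod_cast hw
  have hK' : (0 : ℝ) < K := by exact_mod_cast hK
  have hut' : (u : ℝ) ≤ t := by exact_mod_cast hut
  have hu0 : (0 : ℝ) ≤ u := Nat.cast_nonneg u
  have hA₁' : 2 * ((t : ℝ) * w * K) ≤ A₁ := by exact_mod_cast hA₁
  have htc' : (t : ℝ) * c₁ ≤ (t + 3) * K := by exact_mod_cast htc
  rw [div_le_iff₀ hc₁'] at h
  have h1 : (A₁ : ℝ) * c ≤ (2 - ε) * A * c₁ := by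
    have := mul_le_mul_of_nonneg_right h hc'.le
    calc (A₁ : ℝ) * c ≤ (2 - ε) * ((A : ℝ) / c) * c₁ * c := this
      _ = _ := by field_simp
  have hA₁pos : (0 : ℝ) < A₁ := lt_of_lt_of_le (by positivity) hA₁'
  -- The guarantee itself forces 2 - ε and A to be positive, so ε < 2 need not be assumed.
  have hρA : 0 < (2 - ε) * A := by
    have : 0 < (2 - ε) * A * c₁ := lt_of_lt_of_le (by positivity) h1
    exact pos_of_mul_pos_left this hc₁'.le
  have hApos : (0 : ℝ) < A := by
    rcases (Nat.cast_nonneg A : (0 : ℝ) ≤ A).eq_or_lt with h0 | h0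
    · rw [← h0] at hρA; simp at hρA
    · exact h0
  have h2 : K * (2 * (t : ℝ) * (t * w * c)) ≤ K * ((2 - ε) * A * (t + 3)) := by
    calc K * (2 * (t : ℝ) * (t * w * c)) = t * (2 * (t * w * K) * c) := by ring
      _ ≤ t * (A₁ * c) := by gcongr
      _ ≤ t * ((2 - ε) * A * c₁) := by gcongr
      _ = (2 - ε) * A * (t * c₁) := by ring
      _ ≤ (2 - ε) * A * ((t + 3) * K) := by gcongr
      _ = _ := by ring
  have h3 := le_of_mul_le_mul_left h2 hK'
  -- The quotient of the completeness density 2tw · t/(t+3) by the soundness density tw(u+3)/u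
  -- exceeds 2 - ε. After ε(u+3) ≥ 12 is inserted, 6u < 6t + 18 remains.
  have h4 : (2 - ε) * ((t + 3) * (u + 3)) < 2 * t * u := by
    have : 12 * ((t : ℝ) + 3) ≤ ε * (u + 3) * (t + 3) := by gcongr
    nlinarith
  have h5 : (2 * (t : ℝ)) * (t * w * (u + 3) * c) < 2 * t * (u * A) := by
    calc (2 * (t : ℝ)) * (t * w * (u + 3) * c) = 2 * (t : ℝ) * (t * w * c) * (u + 3) := by ring
      _ ≤ (2 - ε) * A * (t + 3) * (u + 3) := by gcongr
      _ = A * ((2 - ε) * ((t + 3) * (u + 3))) := by ring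
      _ < A * (2 * t * u) := by gcongr
      _ = _ := by ring
  have h6 := lt_of_mul_lt_mul_left h5 (by positivity)
  exact_mod_cast h6

/-- An approximation algorithm gives an algorithm for the gap problem. -/
theorem exists_gap_algorithm {ε : ℝ} (hε : 0 < ε) : ∃ d : ℕ, ∀ (p : Program) (time : ℕ → ℕ → ℕ),
    ApproximatesDALkS (2 - ε) p time → ∃ (P : Program) (e : ℕ),
      ∀ (n : ℕ) (G : SimpleGraph (Fin n)) (k : ℕ), 1 ≤ k → ∃ (s : State) (T : ℕ),
        Exec P (RAM.input G k) s T ∧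
        T ≤ (n + 2) ^ e + 2 * (if k ≤ n then
          time (inputSize (order d n k (copies k)) (threshold d k (copies k)))
            (threshold d k (copies k)) else 0) ∧
        (PolyGapDkS.Completeness (1 / (10 : ℕ)) (d + 1) G k → s.Accepts) ∧
        (PolyGapDkS.Soundness (1 / (10 : ℕ)) G k → ¬ s.Accepts) := by
  obtain ⟨u, hu⟩ := exists_nat_gt (12 / ε)
  have hu' : 12 ≤ ε * ((u : ℝ) + 3) := by
    rw [div_lt_iff₀ hε] at hu
    nlinarith
  have hu1 : 1 ≤ u := by
    have : (0 : ℝ) < u := lt_trans (by positivity) hu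
    exact_mod_cast this
  have hA : 441 ≤ 21 * u * (21 * u) := 
    Nat.mul_le_mul (show 21 ≤ 21 * u by omega) (show 21 ≤ 21 * u by omega)
  have hut : u ≤ 21 * u * (21 * u) * u := Nat.le_mul_of_pos_left _ (by omega)
  have hAt : 21 * u * (21 * u) ≤ 21 * u * (21 * u) * u := Nat.le_mul_of_pos_right _ hu1
  -- With a = 21u the clique size is t = a² u, so that 2a² facets are a 2/u fraction of all t.
  obtain ⟨d, hd⟩ : ∃ d, d + 1 = 21 * u * (21 * u) * u :=
    ⟨21 * u * (21 * u) * u - 1, by omega⟩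
  refine ⟨d, fun p time happ => ?_⟩
  -- For k below (t!)^10 the completeness case is impossible, so rejecting is correct; above it t! ≤
  -- g.
  obtain ⟨P, e, hP⟩ := exists_reduction_program d u ((d + 1).factorial ^ 10) p
  refine ⟨P, e, fun n G k hk => ?_⟩
  obtain ⟨hP1, hP2⟩ := hP n G k hk
  by_cases hguard : k ≤ n ∧ (d + 1).factorial ^ 10 ≤ k
  swap
  · obtain ⟨s, T, hE, hT, hs⟩ := hP1 hguard
    refine ⟨s, T, hE, by omega, fun hc => absurd ⟨?_, hc.factorial_pow_le hk (by norm_num)⟩ hguard,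
      fun _ => hs⟩
    obtain ⟨S, hS, -⟩ := hc
    rw [← hS]
    exact (card_le_univ S).trans (by simp)
  obtain ⟨hkn, hck⟩ := hguard
  set g := Nat.nthRoot 10 k with hg
  have hgt : (d + 1).factorial ≤ g := (Nat.le_nthRoot_iff (by norm_num)).2 hck
  have hgk : g ^ 10 ≤ k := Nat.pow_nthRoot_le (.inl (by norm_num))
  have hkg : k < (g + 1) ^ 10 := Nat.lt_pow_nthRoot_add_one (by norm_num) k
  have hdg : d + 1 ≤ g := (Nat.self_le_factorial _).trans hgt
  have hcop : copies k = g ^ 7 := rfl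
  have hg0 : 0 < g := by omega
  have hKpos : 0 < threshold d k (copies k) := by
    rw [hcop, threshold]
    positivity
  have hKN : threshold d k (copies k) ≤ order d n k (copies k) :=
    threshold_le_order hkn hdg hgk
  obtain ⟨s₀, T₀, hE₀, hT₀, hcard, hbest⟩ :=
    happ _ (graph d n k (copies k) (natAdj G)) _ hKpos hKN
  obtain ⟨s, T, hE, hT, hacc⟩ := hP2 hkn hck s₀ T₀ hE₀
  refine ⟨s, T, hE, ?_, fun hc => ?_, fun hs => ?_⟩
  · rw [if_pos hkn]
    omega
  · rw [hacc, storedSet_eq_map, card_map]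
    obtain ⟨S₀, hS₀, hmany⟩ := hc.exists_many_cliques hk hdg hgk
    have hdk : (d + 1) ^ 2 ≤ k ^ d := by
      have h1 : d + 1 ≤ k := hdg.trans ((Nat.le_self_pow (by norm_num) g).trans hgk)
      calc (d + 1) ^ 2 ≤ k ^ 2 := Nat.pow_le_pow_left h1 2
        _ ≤ k ^ d := Nat.pow_le_pow_right hk (by omega)
    obtain ⟨S₁, hS₁, hKS₁, hS₁t, hS₁A⟩ := exists_dense_set (w := copies k) G S₀ hS₀ hdk hmany
    obtain ⟨S₁, rfl⟩ := exists_map_eq hS₁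
    rw [card_map] at hKS₁ hS₁t
    have hden := hbest S₁ hKS₁
    rw [density_graph, density_graph] at hden
    exact lt_of_density_le (by rw [hcop]; positivity) hKpos hu' (by omega) (by omega)
      (hKpos.trans_le hcard) (hKpos.trans_le hKS₁) hS₁A hS₁t hden
  · rw [hacc, storedSet_eq_map, not_lt]
    -- Rounding the tenth root down costs at most a factor 2.
    have hsparse := fun S hS => hs.card_adj_pairs_le (g := g) (by
      have h1 : (k : ℝ) ≤ (2 * g : ℝ) ^ (10 : ℕ) := by
        have : k ≤ (2 * g) ^ 10 := hkg.le.trans (Nat.pow_le_pow_left (by omega) 10)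
        exact_mod_cast this
      calc (k : ℝ) ^ (1 / (10 : ℕ) : ℝ) ≤ ((2 * g : ℝ) ^ (10 : ℕ)) ^ (1 / (10 : ℕ) : ℝ) :=
            Real.rpow_le_rpow (by positivity) h1 (by positivity)
        _ = 2 * g := by rw [one_div, Real.pow_rpow_inv_natCast (by positivity) (by norm_num)]) S hS
    exact mul_arcCount_le G hu1 rfl hd hgt hgk hkg hsparse _ (by rwa [card_map])

/-- The size of the reduced instance. -/
theorem exists_inputSize_le (d : ℕ) : ∃ e, ∀ n k, k ≤ n →
    inputSize (order d n k (copies k)) (threshold d k (copies k)) ≤ (n + 2) ^ e := by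
  obtain ⟨e₁, h₁, -⟩ := polyComputable_order_params d
  obtain ⟨e₂, h₂, -⟩ := polyComputable_threshold_params d
  refine ⟨e₁ + e₁ + e₂ + 1, fun n k hkn => ?_⟩
  have h1 : order d n k (copies k) ≤ (n + 2) ^ e₁ :=
    h₁ (((), n), k) (fun _ => 0) n (params_bounded hkn)
  have h2 : threshold d k (copies k) ≤ (n + 2) ^ e₂ :=
    h₂ (((), n), k) (fun _ => 0) n (params_bounded hkn)
  rw [inputSize, sq]
  exact add_le_pow_add_two (mul_le_pow_add_two h1 h1)
    ((Nat.size_le.2 Nat.lt_two_pow_self).trans h2)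

end CliqueFacetGraph

/-! ### Transfer of the time bounds -/

theorem le_inputSize (n k : ℕ) : n ≤ inputSize n k :=
  (Nat.le_self_pow (by norm_num) n).trans (Nat.le_add_right _ _)

theorem Polynomial.eval_mono_nat (q : Polynomial ℕ) {x y : ℕ} (h : x ≤ y) : q.eval x ≤ q.eval y := by
  rw [Polynomial.eval_eq_sum_range, Polynomial.eval_eq_sum_range]
  gcongr

end

theorem theorem2 :
    ((∀ δ : ℝ, 0 < δ → δ ≤ 1 → ∀ t : ℕ, 1 ≤ t →
        ¬ ∃ (p : RAM.Program) (q : Polynomial ℕ), SolvesPolyGapDkS δ t p (polyTime q)) →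
      ∀ ε : ℝ, 0 < ε →
        ¬ ∃ (p : RAM.Program) (q : Polynomial ℕ), ApproximatesDALkS (2 - ε) p (polyTime q)) ∧
    ((∀ δ : ℝ, 0 < δ → δ ≤ 1 → ∀ t : ℕ, 1 ≤ t → ∀ f : ℕ → ℕ,
        ¬ ∃ (p : RAM.Program) (c : ℕ), SolvesPolyGapDkS δ t p (fptTime f c)) →
      ∀ ε : ℝ, 0 < ε → ∀ f : ℕ → ℕ,
        ¬ ∃ (p : RAM.Program) (c : ℕ), ApproximatesDALkS (2 - ε) p (fptTime f c)) := by
  refine ⟨fun hno ε hε => ?_, fun hno ε hε f => ?_⟩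
  · rintro ⟨p, q, happ⟩
    obtain ⟨d, hd⟩ := CliqueFacetGraph.exists_gap_algorithm hε
    obtain ⟨P, e, hP⟩ := hd p _ happ
    obtain ⟨e', he'⟩ := CliqueFacetGraph.exists_inputSize_le d
    refine hno (1 / (10 : ℕ)) (by norm_num) (by norm_num) (d + 1) (by omega) ⟨P,
      (Polynomial.X + 2) ^ e + 2 * q.comp ((Polynomial.X + 2) ^ e'), fun n G k hk => ?_⟩
    obtain ⟨s, T, hE, hT, hc, hs⟩ := hP n G k hk
    refine ⟨s, T, hE, hT.trans ?_, hc, hs⟩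
    have hle := le_inputSize n k
    simp only [polyTime, Polynomial.eval_add, Polynomial.eval_mul, Polynomial.eval_pow,
      Polynomial.eval_comp, Polynomial.eval_X, Polynomial.eval_ofNat]
    refine Nat.add_le_add (Nat.pow_le_pow_left (by omega) _) (Nat.mul_le_mul_left _ ?_)
    split_ifs with hkn
    · exact q.eval_mono_nat ((he' n k hkn).trans (Nat.pow_le_pow_left (by omega) _))
    · exact Nat.zero_le _
  · rintro ⟨p, c, happ⟩
    obtain ⟨d, hd⟩ := CliqueFacetGraph.exists_gap_algorithm hε
    obtain ⟨P, e, hP⟩ := hd p _ happ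
    obtain ⟨e', he'⟩ := CliqueFacetGraph.exists_inputSize_le d
    -- The new parameter is a function of k alone, so f evaluated at it is again a function of k.
    -- The power of 3 arises from n + 2 ≤ 3N, which uses N ≥ 1.
    refine hno (1 / (10 : ℕ)) (by norm_num) (by norm_num) (d + 1) (by omega)
      (fun k => (1 + 2 * f (CliqueFacetGraph.threshold d k (CliqueFacetGraph.copies k))) *
        3 ^ (e + e' * c)) ⟨P, e + e' * c, fun n G k hk => ?_⟩
    obtain ⟨s, T, hE, hT, hc, hs⟩ := hP n G k hk
    refine ⟨s, T, hE, hT.trans ?_, hc, hs⟩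
    have hle := le_inputSize n k
    have hpos : 1 ≤ inputSize n k := (Nat.size_pos.2 hk).trans_le (Nat.le_add_left _ _)
    set F := f (CliqueFacetGraph.threshold d k (CliqueFacetGraph.copies k)) with hF
    have h1 : (n + 2) ^ e ≤ (n + 2) ^ (e + e' * c) := Nat.pow_le_pow_right (by omega) (by omega)
    have h2 : (if k ≤ n then fptTime f c (inputSize
        (CliqueFacetGraph.order d n k (CliqueFacetGraph.copies k))
        (CliqueFacetGraph.threshold d k (CliqueFacetGraph.copies k)))
        (CliqueFacetGraph.threshold d k (CliqueFacetGraph.copies k)) else 0) ≤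
        F * (n + 2) ^ (e + e' * c) := by
      split_ifs with hkn
      · refine Nat.mul_le_mul_left _ ((Nat.pow_le_pow_left (he' n k hkn) c).trans ?_)
        rw [← pow_mul]
        exact Nat.pow_le_pow_right (by omega) (by omega)
      · exact Nat.zero_le _
    calc _ ≤ (n + 2) ^ (e + e' * c) + 2 * (F * (n + 2) ^ (e + e' * c)) :=
          Nat.add_le_add h1 (Nat.mul_le_mul_left _ h2)
      _ = (1 + 2 * F) * (n + 2) ^ (e + e' * c) := by ring
      _ ≤ (1 + 2 * F) * (3 * inputSize n k) ^ (e + e' * c) :=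
          Nat.mul_le_mul_left _ (Nat.pow_le_pow_left (by omega) _)
      _ = _ := by rw [fptTime, mul_pow]; ring
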